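/- Let $T=\{1,\dots,n\}$, $n\ge 1$, be a set of teams and $P$ a set of $m$ players. Each team $i$ has an additive valuation $v_i$ on sets of players, with values $v_i(p)\in\mathbb{R}$ of arbitrary sign for the players $p$, and each player $p$ has a weak order $\succsim_p$ on the teams. The rank of team $i$ for $p$ is $1$ plus the number of teams $j$ with $j\succ_p i$. An allocation $A=(A_1,\dots,A_n)$ is an ordered partition of $P$ into $n$ (possibly empty) parts. It is EF1 if for all distinct $i,j$ there are $X\subseteq A_i$, $Y\subseteq A_j$ with $|X\cup Y|\le 1$ and $v_i(A_i\setminus X)\ge v_i(A_j\setminus Y)$. It is swap stable if no swap of two players makes one of the four involved parties (the two players and their teams) better off and none of them worse off, and individually stable if no deviation of a player to another team makes her better off and neither of the two teams involved worse off. Algorithm 1, on a set of players $P'$ and an order $\sigma_1,\dots,\sigma_n$ of the teams: let position $q\in\{1,\dots,|P'|\}$ belong to team $f(q)=\sigma_r$, where $r\in\{1,\dots,n\}$, $r\equiv q \pmod n$, and let $w(q,p)=v_{f(q)}(p)$. Choose a perfect matching $\mu$ between positions and players that makes the weight at position $1$ as large as possible, subject to this the weight at position $2$ as large as possible, and so on.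 Among all perfect matchings $\mu^*$ with $w(q,\mu^*_q)=w(q,\mu_q)$ for all $q$, choose one that minimizes the sum over the players of the rank of the team that she is matched to. Give each player to the team that owns her position in $\mu^*$. Algorithm 2: let $P^+=\{p\in P:\max_i v_i(p)\ge 0\}$ and $P^-=P\setminus P^+$. Add $(n-1)|P^+|+n$ dummy players to $P^+$ and $(n-1)|P^-|+n$ dummy players to $P^-$, where a dummy player has value $0$ for every team and is indifferent between all teams. Run Algorithm 1 on the first set with the order $1,\dots,n$ and on the second set with the order $n,\dots,1$. Return the union of the two allocations with the dummy players removed. Theorem. For every instance, every allocation that Algorithm 2 can return (whichever optimal matchings are chosen) is EF1, swap stable and individually stable. Moreover, Algorithm 2 can be implemented in polynomial time: there is a single program for a random access machine (with unit-cost addition, truncated subtraction and comparison of natural numbers, and, for the real values $v_i(p)$, only comparisons with each other and with $0$) that, for every instance with $n$ teams and $m$ players, computes such an allocation in a number of steps bounded by a polynomial in $n+m$. -/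

import Mathlib

noncomputable section

namespace TeamAlloc

/-! ### Instances and allocations -/

/-- An instance with teams `Fin n` and a set `P` of players. `value i p` is the (arbitrary-sign)
value of player `p` for team `i`; `pref p i j` says that player `p` weakly prefers team `i` to
team `j`, and each `pref p` is a weak order. -/
structure Instance (n : ℕ) (P : Type*) where
  value : Fin n → P → ℝ
  pref : P → Fin n → Fin n → Prop
  pref_total : ∀ p i j, pref p i j ∨ pref p j i
  pref_trans : ∀ p i j k, pref p i j → pref p j k → pref p i k

/-- An allocation is an ordered partition of the players into `n` (possibly empty) parts, given
by the map that sends each player to her team. -/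
abbrev Allocation (n : ℕ) (P : Type*) := P → Fin n

/-- The part assigned to team `i`. -/
def Allocation.bundle {n : ℕ} {P : Type*} [Fintype P] (A : Allocation n P) (i : Fin n) :
    Finset P :=
  Finset.univ.filter (fun p => A p = i)

namespace Instance

variable {n : ℕ} {P : Type*}

/-- The additive valuation of team `i`. -/
def val (I : Instance n P) (i : Fin n) (S : Finset P) : ℝ := ∑ p ∈ S, I.value i p

/-- Player `p` strictly prefers team `i` to team `j`. -/
def strictPref (I : Instance n P) (p : P) (i j : Fin n) : Prop := I.pref p i j ∧ ¬ I.pref p j i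

open Classical in
/-- The rank of team `i` for player `p`: one plus the number of strictly preferred teams. -/
def rank (I : Instance n P) (p : P) (i : Fin n) : ℕ :=
  1 + (Finset.univ.filter (fun j => I.strictPref p j i)).card

/-! ### Fairness and stability -/

/-- Envy-freeness up to one player. -/
def EF1 [Fintype P] [DecidableEq P] (I : Instance n P) (A : Allocation n P) : Prop :=
  ∀ i j : Fin n, i ≠ j → ∃ X Y : Finset P, X ⊆ A.bundle i ∧ Y ⊆ A.bundle j ∧
    (X ∪ Y).card ≤ 1 ∧ I.val i (A.bundle j \ Y) ≤ I.val i (A.bundle i \ X)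

/-- Team `i` is better off in `A'` than in `A`. -/
def TeamBetter [Fintype P] (I : Instance n P) (A A' : Allocation n P) (i : Fin n) : Prop :=
  I.val i (A.bundle i) < I.val i (A'.bundle i)

/-- Team `i` is worse off in `A'` than in `A`. -/
def TeamWorse [Fintype P] (I : Instance n P) (A A' : Allocation n P) (i : Fin n) : Prop :=
  I.val i (A'.bundle i) < I.val i (A.bundle i)

/-- Player `p` is better off in `A'` than in `A`. -/
def PlayerBetter (I : Instance n P) (A A' : Allocation n P) (p : P) : Prop :=
  I.strictPref p (A' p) (A p)

/-- Player `p` is worse off in `A'` than in `A`. -/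
def PlayerWorse (I : Instance n P) (A A' : Allocation n P) (p : P) : Prop :=
  I.strictPref p (A p) (A' p)

/-- The four parties involved in the swap of `p` and `q` are the two players and their teams. -/
def BeneficialSwap [Fintype P] [DecidableEq P] (I : Instance n P) (A : Allocation n P)
    (p q : P) : Prop :=
  let A' : Allocation n P := fun x => A (Equiv.swap p q x)
  (I.PlayerBetter A A' p ∨ I.PlayerBetter A A' q ∨
    I.TeamBetter A A' (A p) ∨ I.TeamBetter A A' (A q)) ∧
  ¬ I.PlayerWorse A A' p ∧ ¬ I.PlayerWorse A A' q ∧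
  ¬ I.TeamWorse A A' (A p) ∧ ¬ I.TeamWorse A A' (A q)

/-- The deviation of `p` to another team `j` makes `p` better off and neither her old team nor
her new team worse off. -/
def BeneficialDeviation [Fintype P] [DecidableEq P] (I : Instance n P) (A : Allocation n P)
    (p : P) (j : Fin n) : Prop :=
  let A' : Allocation n P := Function.update A p j
  j ≠ A p ∧ I.PlayerBetter A A' p ∧ ¬ I.TeamWorse A A' (A p) ∧ ¬ I.TeamWorse A A' j

def SwapStable [Fintype P] [DecidableEq P] (I : Instance n P) (A : Allocation n P) : Prop :=
  ∀ p q, ¬ I.BeneficialSwap A p q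

def IndividuallyStable [Fintype P] [DecidableEq P] (I : Instance n P)
    (A : Allocation n P) : Prop :=
  ∀ p j, ¬ I.BeneficialDeviation A p j

/-! ### The matching-based round-robin algorithm

Positions are numbered from `0`, and a perfect matching between the `|P|` positions and the
players is a bijection `Fin |P| ≃ P`. -/

/-- The team that owns position `q` when the teams take turns in the order
`order 0, order 1, …, order (n - 1)`. -/
def turn [NeZero n] (order : Equiv.Perm (Fin n)) (q : ℕ) : Fin n := order (Fin.ofNat n q)

/-- The weight of the edge between position `q` and player `p`. -/
def weight [NeZero n] (I : Instance n P) (order : Equiv.Perm (Fin n)) (q : ℕ) (p : P) : ℝ :=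
  I.value (turn order q) p

/-- `μ` makes the weight at the first position as large as possible, subject to this the weight
at the second position as large as possible, and so on. -/
def IsLexMaxMatching [NeZero n] [Fintype P] (I : Instance n P) (order : Equiv.Perm (Fin n))
    (μ : Fin (Fintype.card P) ≃ P) : Prop :=
  ∀ (ν : Fin (Fintype.card P) ≃ P) (q : Fin (Fintype.card P)),
    (∀ r : Fin (Fintype.card P), r < q → I.weight order r (ν r) = I.weight order r (μ r)) →
      I.weight order q (ν q) ≤ I.weight order q (μ q)

/-- `ν` is a perfect matching that uses only edges as good for the positions as those in `μ`. -/
def KeepsWeights [NeZero n] [Fintype P] (I : Instance n P) (order : Equiv.Perm (Fin n))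
    (μ ν : Fin (Fintype.card P) ≃ P) : Prop :=
  ∀ q : Fin (Fintype.card P), I.weight order q (ν q) = I.weight order q (μ q)

/-- The sum over all players of the rank of the team that she is matched to. -/
def rankSum [NeZero n] [Fintype P] (I : Instance n P) (order : Equiv.Perm (Fin n))
    (μ : Fin (Fintype.card P) ≃ P) : ℕ :=
  ∑ p, I.rank p (turn order (μ.symm p))

/-- `A` is a possible output of the round-robin algorithm with the given order of teams (the
algorithm may choose any of the optimal matchings). -/
def RoundRobinOutput [NeZero n] [Fintype P] (I : Instance n P) (order : Equiv.Perm (Fin n))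
    (A : Allocation n P) : Prop :=
  ∃ μ μ' : Fin (Fintype.card P) ≃ P,
    I.IsLexMaxMatching order μ ∧
    I.KeepsWeights order μ μ' ∧
    (∀ ν, I.KeepsWeights order μ ν → I.rankSum order μ' ≤ I.rankSum order ν) ∧
    ∀ p, A p = turn order (μ'.symm p)

/-! ### The double round-robin algorithm -/

open Classical in
/-- The players to whom at least one team assigns a nonnegative value, that is, whose maximum
value is nonnegative. -/
def posPlayers [Fintype P] (I : Instance n P) : Finset P :=
  Finset.univ.filter (fun p => ∃ i, 0 ≤ I.value i p)

open Classical in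
/-- The players to whom all teams assign a negative value. -/
def negPlayers [Fintype P] (I : Instance n P) : Finset P :=
  Finset.univ.filter (fun p => ∀ i, I.value i p < 0)

/-- The instance on the players in `S` and `(n - 1) |S| + n` dummy players, who have value `0`
for every team and are indifferent between all teams. -/
def withDummies (I : Instance n P) (S : Finset P) :
    Instance n ({p // p ∈ S} ⊕ Fin ((n - 1) * S.card + n)) where
  value i := Sum.elim (fun p => I.value i p.1) (fun _ => 0)
  pref := Sum.elim (fun p => I.pref p.1) (fun _ _ _ => True)
  pref_total := by
    rintro (p | d) i j
    · exact I.pref_total p.1 i j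
    · exact Or.inl trivial
  pref_trans := by
    rintro (p | d) i j k
    · exact I.pref_trans p.1 i j k
    · exact fun _ _ => trivial

/-- `A` is a possible output of the double round-robin algorithm: the round-robin algorithm in
the forward order `0, 1, …, n - 1` on the nonnegative part, in the backward order
`n - 1, …, 1, 0` on the negative part, each with dummy players, who are then removed. -/
def DoubleRoundRobinOutput [NeZero n] [Fintype P] (I : Instance n P)
    (A : Allocation n P) : Prop :=
  ∃ Apos Aneg,
    (I.withDummies I.posPlayers).RoundRobinOutput (Equiv.refl (Fin n)) Apos ∧
    (I.withDummies I.negPlayers).RoundRobinOutput Fin.revPerm Aneg ∧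
    (∀ p (hp : p ∈ I.posPlayers), A p = Apos (Sum.inl ⟨p, hp⟩)) ∧
    (∀ p (hp : p ∈ I.negPlayers), A p = Aneg (Sum.inl ⟨p, hp⟩))

end Instance

/-! ### A random access machine with a step count

Programs are finite pieces of syntax in a while-language. The memory consists of variables and of
three-dimensional arrays (an unused index is set to `0`), all holding natural numbers, which can
only be added, subtracted (truncated at `0`) and compared. There is no multiplication, so that in
`t` steps only numbers whose length is linear in `t` and in that of the input numbers arise. The
real values lie in a read-only table, and the only thing that a program can do with them is to
compare two entries. Every elementary command and every evaluation of a test takes one step; the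
expressions in a program have a fixed size. -/

/-- The memory. -/
structure Memory where
  var : ℕ → ℕ
  arr : ℕ → ℕ → ℕ → ℕ → ℕ

inductive Expr where
  | const (k : ℕ)
  | var (x : ℕ)
  | arr (a : ℕ) (i j k : Expr)
  | add (e₁ e₂ : Expr)
  | sub (e₁ e₂ : Expr)

def Expr.eval (s : Memory) : Expr → ℕ
  | .const k => k
  | .var x => s.var x
  | .arr a i j k => s.arr a (i.eval s) (j.eval s) (k.eval s)
  | .add e₁ e₂ => e₁.eval s + e₂.eval s
  | .sub e₁ e₂ => e₁.eval s - e₂.eval s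

/-- Tests; `tableLe i j k l` compares the entries `(i, j)` and `(k, l)` of the real table. -/
inductive Test where
  | le (e₁ e₂ : Expr)
  | tableLe (i j k l : Expr)
  | not (b : Test)
  | and (b c : Test)

def Test.holds (R : ℕ → ℕ → ℝ) (s : Memory) : Test → Prop
  | .le e₁ e₂ => e₁.eval s ≤ e₂.eval s
  | .tableLe i j k l => R (i.eval s) (j.eval s) ≤ R (k.eval s) (l.eval s)
  | .not b => ¬ b.holds R s
  | .and b c => b.holds R s ∧ c.holds R s

inductive Prog where
  | skip
  | assign (x : ℕ) (e : Expr)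
  | store (a : ℕ) (i j k e : Expr)
  | seq (c d : Prog)
  | ite (b : Test) (c d : Prog)
  | loop (b : Test) (c : Prog)

/-- Overwrite the variable `x`. -/
def Memory.setVar (s : Memory) (x v : ℕ) : Memory :=
  { s with var := fun y => if y = x then v else s.var y }

/-- Overwrite the cell `(i, j, k)` of the array `a`. -/
def Memory.setArr (s : Memory) (a i j k v : ℕ) : Memory :=
  { s with arr := fun a' i' j' k' =>
      if a' = a ∧ i' = i ∧ j' = j ∧ k' = k then v else s.arr a' i' j' k' }

/-- `Exec R c s t s'`: with the real table `R`, the program `c` started in memory `s` halts after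
exactly `t` steps in memory `s'`. The command `loop b c` repeats `c` as long as `b` holds. -/
inductive Exec (R : ℕ → ℕ → ℝ) : Prog → Memory → ℕ → Memory → Prop where
  | skip (s : Memory) : Exec R .skip s 1 s
  | assign (s : Memory) (x : ℕ) (e : Expr) :
      Exec R (.assign x e) s 1 (s.setVar x (e.eval s))
  | store (s : Memory) (a : ℕ) (i j k e : Expr) :
      Exec R (.store a i j k e) s 1
        (s.setArr a (i.eval s) (j.eval s) (k.eval s) (e.eval s))
  | seq {c d : Prog} {s s' s'' : Memory} {t u : ℕ} :
      Exec R c s t s' → Exec R d s' u s'' → Exec R (.seq c d) s (t + u) s''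
  | ite_true {b : Test} {c d : Prog} {s s' : Memory} {t : ℕ} :
      b.holds R s → Exec R c s t s' → Exec R (.ite b c d) s (1 + t) s'
  | ite_false {b : Test} {c d : Prog} {s s' : Memory} {t : ℕ} :
      ¬ b.holds R s → Exec R d s t s' → Exec R (.ite b c d) s (1 + t) s'
  | loop_false {b : Test} {c : Prog} {s : Memory} :
      ¬ b.holds R s → Exec R (.loop b c) s 1 s
  | loop_true {b : Test} {c : Prog} {s s' s'' : Memory} {t u : ℕ} :
      b.holds R s → Exec R c s t s' → Exec R (.loop b c) s' u s'' →
      Exec R (.loop b c) s (1 + t + u) s''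

/-! ### Input and output format -/

/-- The real table of an instance: entry `(i, p)` is the value of player `p` for team `i`, and
all entries outside the range are `0`. -/
def Instance.table {n m : ℕ} (I : Instance n (Fin m)) (i p : ℕ) : ℝ :=
  if h : i < n ∧ p < m then I.value ⟨i, h.1⟩ ⟨p, h.2⟩ else 0

open Classical in
/-- The initial memory: variables `0` and `1` hold the numbers of teams and of players, array `0`
holds the 0-1 table of the players' weak preferences, everything else is `0`. -/
def Instance.input {n m : ℕ} (I : Instance n (Fin m)) : Memory where
  var x := if x = 0 then n else if x = 1 then m else 0
  arr a p i j :=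
    if a = 0 ∧ ∃ (hp : p < m) (hi : i < n) (hj : j < n), I.pref ⟨p, hp⟩ ⟨i, hi⟩ ⟨j, hj⟩
    then 1 else 0

/-- The allocation `A` can be read off the final memory: the team of player `p` is the entry
`(p, 0, 0)` of array `1`. -/
def Memory.Encodes {n m : ℕ} (s : Memory) (A : Allocation n (Fin m)) : Prop :=
  ∀ p : Fin m, s.arr 1 p 0 0 = A p

/-- The double round-robin algorithm runs in polynomial time: there is a single program that, for
every instance with `n` teams and `m` players, halts after a number of steps polynomial in `n` and
`m` and leaves a possible output of the algorithm in memory. -/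
def DoubleRoundRobinPolyTime : Prop :=
  ∃ (c : Prog) (b : Polynomial ℕ), ∀ (n m : ℕ) [NeZero n] (I : Instance n (Fin m)),
    ∃ (t : ℕ) (s : Memory) (A : Allocation n (Fin m)),
      Exec I.table c I.input t s ∧ t ≤ b.eval (n + m) ∧
      s.Encodes A ∧ I.DoubleRoundRobinOutput A

end TeamAlloc

end

set_option linter.unusedSectionVars false

namespace TeamAlloc

/-! ### Ranks and strict preference -/

namespace Instance

variable {n : ℕ} {P : Type*}

/-! Stability rests on one exchange argument, `RoundRobinOutput.swap`. If two players trade places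
and neither team loses, lexicographic maximality forces both teams to be indifferent. The traded
matching then keeps all weights and competes in the rank minimization, so the two players' rank sum
cannot drop. Hence no swap inside one part is beneficial. The dummies extend this to deviations:
every team has `|S| + 1` positions but there are only `|S|` real players, so every team owns a dummy
(`exists_dummy`), and moving to a team amounts to trading with its dummy. The same trade shows that
no team holds a nonnegative-part player whom it values negatively (`value_nonneg`), which rules out
beneficial swaps across the two parts.

For EF1, compare picks round by round. A team does not envy those after it in the order
(`val_bundle_le`). Towards any team, its envy disappears once its own last pick and the other team's
first pick are discarded (`val_bundle_sub_le`). In the nonnegative part the own last pick is worth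
at least 0 and need not be removed; in the negative part the other team's first pick is worth 0,
because the `n` or more dummies cannot all sit before it. The two parts use opposite orders, so for
each ordered pair of teams only one part needs a removal.

For the running time, the lexicographic optimum is found row by row without large weights. Each
stage is an assignment problem whose costs count the better columns for one row, while columns below
an earlier row's target carry a penalty that outweighs all other costs (`StageInv.step`). A last run
adds the ranks (`StageInv.final`). Each problem is solved by an auction with bid increment 1: the
result is within `N` of the optimum, and exact since costs are multiples of `N + 1`. Prices are
bounded and each bid raises one, so the number of bids is polynomial. `Runs` carries correctness and
step bounds together through the program. -/

theorem rank_le_of_pref (I : Instance n P) {p : P} {i j : Fin n} (h : I.pref p i j) :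
    I.rank p i ≤ I.rank p j := by
  classical
  unfold rank
  refine Nat.add_le_add_left (Finset.card_le_card fun k hk => ?_) 1
  rw [Finset.mem_filter] at hk ⊢
  exact ⟨hk.1, I.pref_trans _ _ _ _ hk.2.1 h,
    fun h' => hk.2.2 (I.pref_trans _ _ _ _ h h')⟩

theorem rank_lt_of_strictPref (I : Instance n P) {p : P} {i j : Fin n}
    (h : I.strictPref p i j) : I.rank p i < I.rank p j := by
  classical
  unfold rank
  refine Nat.add_lt_add_left (Finset.card_lt_card ((Finset.ssubset_iff_of_subset ?_).2
    ⟨i, ?_, ?_⟩)) 1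
  · intro k hk
    rw [Finset.mem_filter] at hk ⊢
    exact ⟨hk.1, I.pref_trans _ _ _ _ hk.2.1 h.1,
      fun h' => hk.2.2 (I.pref_trans _ _ _ _ h.1 h')⟩
  · exact Finset.mem_filter.2 ⟨Finset.mem_univ _, h⟩
  · rw [Finset.mem_filter]
    exact fun h' => h'.2.2 h'.2.1

theorem rank_le_of_not_strictPref (I : Instance n P) {p : P} {i j : Fin n}
    (h : ¬ I.strictPref p j i) : I.rank p i ≤ I.rank p j := by
  apply I.rank_le_of_pref
  by_contra h'
  exact h ⟨(I.pref_total p i j).resolve_left h', h'⟩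

/-! ### Exchanges in lexicographically maximal matchings -/

section Matching

variable [NeZero n] [Fintype P] {I : Instance n P} {order : Equiv.Perm (Fin n)}
  {μ ν : Fin (Fintype.card P) ≃ P}

theorem IsLexMaxMatching.of_keepsWeights (h : I.IsLexMaxMatching order μ)
    (hν : I.KeepsWeights order μ ν) : I.IsLexMaxMatching order ν := by
  intro ξ q hq
  rw [hν q]
  exact h ξ q fun r hr => (hq r hr).trans (hν r)

/-- Exchanging the players at `a` and `b` leaves all positions before `a` alone, so maximality
applies at `a`. -/
theorem IsLexMaxMatching.weight_le (h : I.IsLexMaxMatching order μ)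
    {a b : Fin (Fintype.card P)} (hab : a ≤ b) :
    I.weight order a (μ b) ≤ I.weight order a (μ a) := by
  have := h ((Equiv.swap a b).trans μ) a fun r hr => by
    simp [Equiv.swap_apply_of_ne_of_ne hr.ne (hr.trans_le hab).ne]
  simpa using this

/-- Maximality at `a` turns the first inequality into an equality; the exchanged matching then
agrees in weight up to `b`, so maximality applies there as well. -/
theorem IsLexMaxMatching.keepsWeights_swap (h : I.IsLexMaxMatching order μ)
    {a b : Fin (Fintype.card P)} (hab : a < b)
    (ha : I.weight order a (μ a) ≤ I.weight order a (μ b))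
    (hb : I.weight order b (μ b) ≤ I.weight order b (μ a)) :
    I.weight order a (μ b) = I.weight order a (μ a) ∧
      I.weight order b (μ a) = I.weight order b (μ b) := by
  have ha' := le_antisymm (h.weight_le hab.le) ha
  refine ⟨ha', le_antisymm ?_ hb⟩
  have := h ((Equiv.swap a b).trans μ) b fun r hr => by
    by_cases hra : r = a
    · subst hra; simpa using ha'
    · simp [Equiv.swap_apply_of_ne_of_ne hra hr.ne]
  simpa using this

/-- The exchange argument behind all stability claims: an exchange that hurts neither team preserves
every weight, so the exchanged matching is a candidate in the rank minimization. -/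
theorem RoundRobinOutput.swap [DecidableEq P] {A : Allocation n P}
    (h : I.RoundRobinOutput order A) {x y : P} (hx : I.value (A x) x ≤ I.value (A x) y)
    (hy : I.value (A y) y ≤ I.value (A y) x) :
    I.value (A x) y = I.value (A x) x ∧ I.value (A y) x = I.value (A y) y ∧
      (x ≠ y → I.rank x (A x) + I.rank y (A y) ≤ I.rank x (A y) + I.rank y (A x)) := by
  obtain ⟨μ, μ', hμ, hk, hmin, hA⟩ := h
  have hlex := hμ.of_keepsWeights hk
  have hval : I.value (A x) y = I.value (A x) x ∧ I.value (A y) x = I.value (A y) y := by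
    rw [hA, hA] at *
    have hw : ∀ u v, I.value (turn order (μ'.symm u)) v =
        I.weight order (μ'.symm u) (μ' (μ'.symm v)) := fun u v => by simp [weight]
    rcases lt_trichotomy (μ'.symm x) (μ'.symm y) with hlt | heq | hlt
    · simp only [hw] at hx hy ⊢
      exact hlex.keepsWeights_swap hlt hx hy
    · have : x = y := μ'.symm.injective heq
      subst this; simp
    · simp only [hw] at hx hy ⊢
      exact (hlex.keepsWeights_swap hlt hy hx).symm
  refine ⟨hval.1, hval.2, fun hne => ?_⟩
  have hle := hmin (μ'.trans (Equiv.swap x y)) fun q => by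
    rw [← hk q]
    obtain ⟨p, rfl⟩ := μ'.symm.surjective q
    simp only [weight, ← hA, Equiv.trans_apply, Equiv.apply_symm_apply]
    by_cases hpx : p = x
    · subst hpx; simpa using hval.1
    by_cases hpy : p = y
    · subst hpy; simpa using hval.2
    rw [Equiv.swap_apply_of_ne_of_ne hpx hpy]
  simp only [rankSum, Equiv.symm_trans_apply, Equiv.symm_swap, ← hA] at hle
  -- The two rank sums differ only in the summands of `x` and `y`.
  rw [← Finset.sum_add_sum_compl {x, y} (fun p => I.rank p (A p)),
    ← Finset.sum_add_sum_compl {x, y} (fun p => I.rank p (A (Equiv.swap x y p))),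
    Finset.sum_pair hne, Finset.sum_pair hne] at hle
  have : ∑ p ∈ ({x, y} : Finset P)ᶜ, I.rank p (A (Equiv.swap x y p)) =
      ∑ p ∈ ({x, y} : Finset P)ᶜ, I.rank p (A p) := by
    refine Finset.sum_congr rfl fun p hp => ?_
    simp only [Finset.mem_compl, Finset.mem_insert, Finset.mem_singleton, not_or] at hp
    rw [Equiv.swap_apply_of_ne_of_ne hp.1 hp.2]
  rw [this] at hle
  simpa using hle

/-- The player whom the team at place `s` of the order picks in round `k`. -/
theorem RoundRobinOutput.exists_seat {A : Allocation n P} (h : I.RoundRobinOutput order A)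
    {L : ℕ} (hL : Fintype.card P = L * n) :
    ∃ seat : Fin L × Fin n ≃ P, (∀ k s, A (seat (k, s)) = order s) ∧
      ∀ (k : Fin L) (s : Fin n) (k' : Fin L) (s' : Fin n), (s : ℕ) + n * k ≤ s' + n * k' →
        I.value (order s) (seat (k', s')) ≤ I.value (order s) (seat (k, s)) := by
  obtain ⟨μ, μ', hμ, hk, -, hA⟩ := h
  have hlex := hμ.of_keepsWeights hk
  have hturn : ∀ (s : Fin n) (k : ℕ), turn order (s + n * k) = order s := fun s k => by
    unfold turn
    congr 1
    ext
    simp [Fin.ofNat, Nat.mod_eq_of_lt s.2]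
  -- `finProdFinEquiv` sends `(k, s)` to `s + n * k`, the position of place `s` in round `k`; `μ'`
  -- then gives its player.
  refine ⟨(finProdFinEquiv.trans (finCongr hL.symm)).trans μ', fun k s => ?_,
    fun k s k' s' hle => ?_⟩
  · rw [hA]
    simp [hturn]
  · have := hlex.weight_le (a := finCongr hL.symm (finProdFinEquiv (k, s)))
      (b := finCongr hL.symm (finProdFinEquiv (k', s'))) (by simpa [Fin.le_def] using hle)
    simpa [weight, hturn] using this

end Matching

/-! ### Round-by-round comparison of bundles -/

section Seats

variable [Fintype P] {I : Instance n P} {order : Equiv.Perm (Fin n)} {A : Allocation n P}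

theorem val_bundle_eq_sum_seat {L : ℕ} {seat : Fin L × Fin n ≃ P}
    (hs : ∀ k s, A (seat (k, s)) = order s) (i j : Fin n) :
    I.val i (A.bundle j) = ∑ k, I.value i (seat (k, order.symm j)) := by
  rw [val, Allocation.bundle, Finset.sum_filter, ← seat.sum_comp, Fintype.sum_prod_type]
  refine Finset.sum_congr rfl fun k _ => ?_
  rw [Finset.sum_eq_single (order.symm j)]
  · simp [hs]
  · intro s _ hne
    rw [if_neg]
    rw [hs]
    rintro rfl
    simp at hne
  · simp

variable [NeZero n]

/-- In each round `i` picks before `j`, so the inequality holds seat by seat. -/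
theorem RoundRobinOutput.val_bundle_le (h : I.RoundRobinOutput order A) {L : ℕ}
    (hL : Fintype.card P = L * n) {i j : Fin n} (hij : order.symm i < order.symm j) :
    I.val i (A.bundle j) ≤ I.val i (A.bundle i) := by
  obtain ⟨seat, hs, hle⟩ := h.exists_seat hL
  rw [val_bundle_eq_sum_seat hs, val_bundle_eq_sum_seat hs]
  refine Finset.sum_le_sum fun k _ => ?_
  simpa using hle k (order.symm i) k (order.symm j) (by simpa using hij.le)

/-- Up to the last pick `x` of `i` and the first pick `y` of `j`, team `i` does not envy `j`. -/
theorem RoundRobinOutput.val_bundle_sub_le (h : I.RoundRobinOutput order A) {L : ℕ}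
    (hL : Fintype.card P = (L + 1) * n) (i j : Fin n) :
    ∃ x y, A x = i ∧ A y = j ∧
      I.val i (A.bundle j) - I.value i y ≤ I.val i (A.bundle i) - I.value i x ∧
      ∀ D : Finset P, n ≤ D.card → ∃ z ∈ D, I.value j z ≤ I.value j y := by
  classical
  obtain ⟨seat, hs, hle⟩ := h.exists_seat hL
  refine ⟨seat (Fin.last L, order.symm i), seat (0, order.symm j), by simp [hs], by simp [hs],
    ?_, fun D hD => ?_⟩
  -- Without `j`'s first and `i`'s last pick, round `k` of `i` is paired with round `k + 1` of `j`,
  -- which comes later whatever the order of the teams.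
  · rw [val_bundle_eq_sum_seat hs, val_bundle_eq_sum_seat hs, Fin.sum_univ_succ,
      Fin.sum_univ_castSucc (fun k => I.value i (seat (k, order.symm i))), add_sub_cancel_left,
      add_sub_cancel_right]
    refine Finset.sum_le_sum fun k _ => ?_
    have := hle k.castSucc (order.symm i) k.succ (order.symm j) (by
      have := (order.symm i).2
      simp only [Fin.val_castSucc, Fin.val_succ]
      nlinarith)
    simpa using this
  -- Otherwise every element of `D` would have been taken before `j`'s first pick, in one of fewer
  -- than `n` positions.
  · by_contra! hlt
    have hsub : D ⊆ (Finset.univ.filter fun s : Fin n => s < order.symm j).image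
        fun s => seat (0, s) := by
      intro z hz
      obtain ⟨⟨k, s⟩, rfl⟩ := seat.surjective z
      have hks : ¬ ((order.symm j : Fin n) : ℕ) + n * ((0 : Fin (L + 1)) : ℕ) ≤ s + n * k :=
        fun hle' => absurd (hlt _ hz) (not_lt.2 (by simpa using hle _ _ _ _ hle'))
      have hj := (order.symm j).2
      simp only [Fin.val_zero, mul_zero, add_zero, not_le] at hks
      have hk : k = 0 := by
        by_contra hk
        have : 1 ≤ (k : ℕ) := Nat.one_le_iff_ne_zero.2 fun h0 => hk (Fin.ext h0)
        nlinarith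
      subst hk
      simp only [Finset.mem_image, Finset.mem_filter, Finset.mem_univ, true_and]
      exact ⟨s, Fin.lt_def.2 ((Nat.le_add_right _ _).trans_lt hks), rfl⟩
    have h1 := (Finset.card_le_card hsub).trans Finset.card_image_le
    have h2 : (Finset.univ.filter fun s : Fin n => s < order.symm j).card < n := by
      have : (Finset.univ.filter fun s : Fin n => s < order.symm j) ⊂ Finset.univ :=
        (Finset.ssubset_iff_of_subset (Finset.subset_univ _)).2
          ⟨order.symm j, Finset.mem_univ _, by simp⟩
      simpa using Finset.card_lt_card this
    omega

end Seats

/-! ### The effect of the dummy players -/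

section Dummies

variable [NeZero n] [Fintype P] {I : Instance n P} {S : Finset P}
  {order : Equiv.Perm (Fin n)}
  {A : Allocation n ({p // p ∈ S} ⊕ Fin ((n - 1) * S.card + n))}

/-- The number of dummies is chosen to make exactly `|S| + 1` complete rounds. -/
theorem card_withDummies (n : ℕ) [NeZero n] (S : Finset P) :
    Fintype.card ({p // p ∈ S} ⊕ Fin ((n - 1) * S.card + n)) = (S.card + 1) * n := by
  obtain ⟨k, hk⟩ := Nat.exists_eq_succ_of_ne_zero (NeZero.ne n)
  subst hk
  simp only [Fintype.card_sum, Fintype.card_coe, Fintype.card_fin, Nat.succ_eq_add_one,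
    Nat.add_sub_cancel]
  ring

/-- Pigeonhole: `|S| + 1` seats per team, only `|S|` real players. -/
theorem RoundRobinOutput.exists_dummy (h : (I.withDummies S).RoundRobinOutput order A)
    (j : Fin n) : ∃ d, A (Sum.inr d) = j := by
  by_contra! hne
  obtain ⟨seat, hs, -⟩ := h.exists_seat (card_withDummies n S)
  have hreal : ∀ k, ∃ p, seat (k, order.symm j) = Sum.inl p := fun k => by
    rcases hp : seat (k, order.symm j) with p | d
    · exact ⟨p, rfl⟩
    · exact absurd (by rw [← hp, hs]; simp) (hne d)
  choose f hf using hreal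
  have hinj : Function.Injective f := fun k k' hkk => by
    have : seat (k, order.symm j) = seat (k', order.symm j) := by rw [hf, hf, hkk]
    simpa using this
  have := Fintype.card_le_of_injective f hinj
  simp at this

/-- Otherwise the player could be exchanged for a dummy of a team that does not mind her, with a
strict gain for her present team. -/
theorem RoundRobinOutput.value_nonneg (h : (I.withDummies S).RoundRobinOutput order A)
    (hS : ∀ p ∈ S, ∃ i, 0 ≤ I.value i p) (x) : 0 ≤ (I.withDummies S).value (A x) x := by
  classical
  rcases x with p | d
  · obtain ⟨j, hj⟩ := hS p.1 p.2
    obtain ⟨d, hd⟩ := h.exists_dummy j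
    by_contra! hlt
    have := (h.swap (x := Sum.inl p) (y := Sum.inr d) (by simpa [withDummies] using hlt.le)
      (by simpa [withDummies, hd] using hj)).1
    rw [← this] at hlt
    simp [withDummies] at hlt
  · simp [withDummies]

end Dummies

/-! ### Fairness and stability of the combined allocation -/

section DoubleRoundRobin

variable [NeZero n] [Fintype P] [DecidableEq P] {I : Instance n P} {A : Allocation n P}

theorem mem_posPlayers {p : P} : p ∈ I.posPlayers ↔ ∃ i, 0 ≤ I.value i p := by
  simp [posPlayers]

theorem mem_negPlayers {p : P} : p ∈ I.negPlayers ↔ ∀ i, I.value i p < 0 := by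
  simp [negPlayers]

theorem notMem_negPlayers {p : P} : p ∉ I.negPlayers ↔ p ∈ I.posPlayers := by
  simp [posPlayers, negPlayers]

theorem val_withDummies_bundle {S : Finset P}
    {B : Allocation n ({p // p ∈ S} ⊕ Fin ((n - 1) * S.card + n))}
    (hB : ∀ p (hp : p ∈ S), A p = B (Sum.inl ⟨p, hp⟩)) (i j : Fin n) :
    (I.withDummies S).val i (B.bundle j) = ∑ p ∈ S, if A p = j then I.value i p else 0 := by
  rw [val, Allocation.bundle, Finset.sum_filter, Fintype.sum_sum_type]
  simp only [withDummies, Sum.elim_inl, Sum.elim_inr, ite_self, Finset.sum_const_zero, add_zero]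
  rw [← Finset.sum_coe_sort S]
  exact Finset.sum_congr rfl fun p _ => by rw [hB p.1 p.2]

theorem val_bundle_eq_add (i j : Fin n) :
    I.val i (A.bundle j) = (∑ p ∈ I.posPlayers, if A p = j then I.value i p else 0) +
      ∑ p ∈ I.negPlayers, if A p = j then I.value i p else 0 := by
  have hneg : I.negPlayers = I.posPlayersᶜ := by
    ext p
    rw [Finset.mem_compl, ← notMem_negPlayers, not_not]
  rw [hneg, Finset.sum_add_sum_compl, val, Allocation.bundle, Finset.sum_filter]

theorem val_bundle_sdiff_singleton {p : P} {j : Fin n} (hp : A p = j) (i : Fin n) :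
    I.val i (A.bundle j \ {p}) = I.val i (A.bundle j) - I.value i p := by
  have hsub : {p} ⊆ A.bundle j := by simpa [Allocation.bundle] using hp
  have := Finset.sum_sdiff (f := fun p => I.value i p) hsub
  simp only [Finset.sum_singleton] at this
  simp only [val]
  linarith

/-- Carries a removal back to the real players; removing a dummy becomes removing nobody. -/
theorem exists_removal {S : Finset P}
    {B : Allocation n ({p // p ∈ S} ⊕ Fin ((n - 1) * S.card + n))}
    (hB : ∀ p (hp : p ∈ S), A p = B (Sum.inl ⟨p, hp⟩)) {j : Fin n} {x} (hx : B x = j)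
    (i : Fin n) : ∃ X ⊆ A.bundle j, X.card ≤ 1 ∧
      I.val i (A.bundle j \ X) = I.val i (A.bundle j) - (I.withDummies S).value i x := by
  rcases x with p | d
  · have hp : A p.1 = j := by rw [hB p.1 p.2, ← hx]
    exact ⟨{p.1}, by simpa [Allocation.bundle] using hp, by simp,
      val_bundle_sdiff_singleton hp i⟩
  · exact ⟨∅, by simp, by simp, by simp [withDummies]⟩

theorem DoubleRoundRobinOutput.ef1 (h : I.DoubleRoundRobinOutput A) : I.EF1 A := by
  obtain ⟨B, C, hB, hC, hAB, hAC⟩ := h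
  intro i j hij
  have hBval := val_withDummies_bundle (I := I) hAB
  have hCval := val_withDummies_bundle (I := I) hAC
  rcases lt_or_gt_of_ne hij with hlt | hlt
  -- Here `i` comes first in the forward order, so envy can only arise in the negative part, and `i`
  -- gives up her last pick there.
  · have h1 := hB.val_bundle_le (card_withDummies n _) (i := i) (j := j) (by simpa using hlt)
    obtain ⟨x, y, hx, hy, h2, hD⟩ := hC.val_bundle_sub_le (card_withDummies n _) i j
    obtain ⟨z, hz, hzy⟩ := hD (Finset.univ.image Sum.inr) (by
      rw [Finset.card_image_of_injective _ Sum.inr_injective]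
      simp)
    -- A real `y` would be worth less than 0 to `j`, hence less than the dummy `z`. So `y` is a
    -- dummy, worth 0 to `i` too.
    have hy0 : (I.withDummies I.negPlayers).value i y = 0 := by
      rcases y with p | d
      · simp only [Finset.mem_image, Finset.mem_univ, true_and] at hz
        obtain ⟨d, rfl⟩ := hz
        have := mem_negPlayers.1 p.2 j
        simp only [withDummies, Sum.elim_inl, Sum.elim_inr] at hzy
        linarith
      · simp [withDummies]
    obtain ⟨X, hX, hX1, hXv⟩ := exists_removal (I := I) hAC hx i
    refine ⟨X, ∅, hX, by simp, by simpa using hX1, ?_⟩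
    rw [hXv, Finset.sdiff_empty, val_bundle_eq_add, val_bundle_eq_add]
    rw [hBval, hBval] at h1
    rw [hCval, hCval] at h2
    linarith
  -- Here `i` comes first in the backward order; the envied team's first pick in the nonnegative
  -- part is removed, and `i`'s own last pick is worth at least 0.
  · have h1 := hC.val_bundle_le (card_withDummies n _) (i := i) (j := j) (by simpa using hlt)
    obtain ⟨x, y, hx, hy, h2, -⟩ := hB.val_bundle_sub_le (card_withDummies n _) i j
    have hx0 := hB.value_nonneg (fun p hp => mem_posPlayers.1 hp) x
    rw [hx] at hx0
    obtain ⟨Y, hY, hY1, hYv⟩ := exists_removal (I := I) hAB hy i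
    refine ⟨∅, Y, by simp, hY, by simpa using hY1, ?_⟩
    rw [hYv, Finset.sdiff_empty, val_bundle_eq_add, val_bundle_eq_add]
    rw [hCval, hCval] at h1
    rw [hBval, hBval] at h2
    linarith

theorem val_bundle_swap {p q : P} (hpq : A p ≠ A q) (i : Fin n) :
    I.val i (Allocation.bundle (fun x => A (Equiv.swap p q x)) (A p)) =
      I.val i (A.bundle (A p)) - I.value i p + I.value i q := by
  have hne : p ≠ q := fun h => hpq (by rw [h])
  simp only [val, Allocation.bundle, Finset.sum_filter]
  rw [← Finset.sum_add_sum_compl {p, q}, Finset.sum_pair hne,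
    ← Finset.sum_add_sum_compl {p, q} (fun x => if A x = A p then I.value i x else 0),
    Finset.sum_pair hne]
  have : ∑ x ∈ ({p, q} : Finset P)ᶜ, (if A (Equiv.swap p q x) = A p then I.value i x else 0) =
      ∑ x ∈ ({p, q} : Finset P)ᶜ, if A x = A p then I.value i x else 0 := by
    refine Finset.sum_congr rfl fun x hx => ?_
    simp only [Finset.mem_compl, Finset.mem_insert, Finset.mem_singleton, not_or] at hx
    rw [Equiv.swap_apply_of_ne_of_ne hx.1 hx.2]
  rw [this]
  simp [hpq.symm]
  ring

theorem DoubleRoundRobinOutput.swapStable (h : I.DoubleRoundRobinOutput A) :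
    I.SwapStable A := by
  intro p q hswap
  by_cases hpq : A p = A q
  · have : (fun x => A (Equiv.swap p q x)) = A := by
      funext x
      by_cases hxp : x = p
      · subst hxp; simp [hpq]
      by_cases hxq : x = q
      · subst hxq; simp [hpq]
      rw [Equiv.swap_apply_of_ne_of_ne hxp hxq]
    simp only [BeneficialSwap, this, PlayerBetter, TeamBetter, strictPref, Equiv.swap_apply_left,
      Equiv.swap_apply_right, hpq, and_not_self, lt_self_iff_false, or_self, false_and] at hswap
  have hvp := fun i => val_bundle_swap (I := I) hpq i
  have hvq := fun i => val_bundle_swap (I := I) (Ne.symm hpq) i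
  simp only [Equiv.swap_comm q p] at hvq
  simp only [BeneficialSwap, PlayerBetter, PlayerWorse, TeamBetter, TeamWorse, hvp, hvq,
    Equiv.swap_apply_left, Equiv.swap_apply_right] at hswap
  obtain ⟨hb, hwp, hwq, htp, htq⟩ := hswap
  have htp' : I.value (A p) p ≤ I.value (A p) q := by linarith
  have htq' : I.value (A q) q ≤ I.value (A q) p := by linarith
  have hne : p ≠ q := fun h => hpq (by rw [h])
  obtain ⟨B, C, hB, hC, hAB, hAC⟩ := h
  -- Two players of the same part: the exchange lemma excludes a gain for the teams and a smaller
  -- rank sum for the players.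
  have key : ∀ (S : Finset P) (order : Equiv.Perm (Fin n))
      (D : Allocation n ({p // p ∈ S} ⊕ Fin ((n - 1) * S.card + n))),
      (I.withDummies S).RoundRobinOutput order D →
      (∀ p (hp : p ∈ S), A p = D (Sum.inl ⟨p, hp⟩)) → p ∈ S → q ∈ S → False := by
    intro S order D hD hAD hp hq
    obtain ⟨e1, e2, hr⟩ := hD.swap (x := Sum.inl ⟨p, hp⟩) (y := Sum.inl ⟨q, hq⟩)
      (by simpa [withDummies, ← hAD] using htp') (by simpa [withDummies, ← hAD] using htq')
    have hr := hr (by simpa using hne)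
    simp only [← hAD] at e1 e2 hr
    simp only [withDummies, Sum.elim_inl] at e1 e2
    have hr' : I.rank p (A p) + I.rank q (A q) ≤ I.rank p (A q) + I.rank q (A p) := hr
    have r1 := I.rank_le_of_not_strictPref hwp
    have r2 := I.rank_le_of_not_strictPref hwq
    rcases hb with hb | hb | hb | hb
    · have := I.rank_lt_of_strictPref hb
      omega
    · have := I.rank_lt_of_strictPref hb
      omega
    · linarith
    · linarith
  by_cases hp : p ∈ I.posPlayers <;> by_cases hq : q ∈ I.posPlayers
  · exact key _ _ _ hB hAB hp hq
  -- In a mixed pair, the team of the nonnegative-part player would trade a value of at least 0 for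
  -- a negative one.
  · rw [← notMem_negPlayers, not_not, mem_negPlayers] at hq
    have := hB.value_nonneg (fun p hp => mem_posPlayers.1 hp) (Sum.inl ⟨p, hp⟩)
    rw [← hAB] at this
    simp only [withDummies, Sum.elim_inl] at this
    linarith [hq (A p)]
  · rw [← notMem_negPlayers, not_not, mem_negPlayers] at hp
    have := hB.value_nonneg (fun p hp => mem_posPlayers.1 hp) (Sum.inl ⟨q, hq⟩)
    rw [← hAB] at this
    simp only [withDummies, Sum.elim_inl] at this
    linarith [hp (A q)]
  · rw [← notMem_negPlayers, not_not] at hp hq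
    exact key _ _ _ hC hAC hp hq

theorem bundle_update_of_ne {p : P} {j : Fin n} (hj : j ≠ A p) :
    Allocation.bundle (Function.update A p j) (A p) = A.bundle (A p) \ {p} := by
  ext x
  by_cases hx : x = p
  · subst hx; simp [Allocation.bundle, hj]
  · simp [Allocation.bundle, hx]

theorem bundle_update_self (p : P) (j : Fin n) :
    Allocation.bundle (Function.update A p j) j = insert p (A.bundle j) := by
  ext x
  by_cases hx : x = p
  · subst hx; simp [Allocation.bundle]
  · simp [Allocation.bundle, hx]

/-- A deviation to `j` in the nonnegative part is an exchange with a dummy of `j`; a player whom all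
teams value negatively harms any team that she joins. -/
theorem DoubleRoundRobinOutput.individuallyStable (h : I.DoubleRoundRobinOutput A) :
    I.IndividuallyStable A := by
  intro p j hdev
  obtain ⟨hj, hb, ht, ht'⟩ := hdev
  simp only [PlayerBetter, Function.update_self] at hb
  simp only [TeamWorse] at ht ht'
  rw [bundle_update_of_ne hj, val_bundle_sdiff_singleton rfl] at ht
  have hpj : p ∉ A.bundle j := by simpa [Allocation.bundle] using hj.symm
  rw [bundle_update_self, val, val, Finset.sum_insert hpj] at ht'
  obtain ⟨B, C, hB, hC, hAB, hAC⟩ := h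
  by_cases hp : p ∈ I.posPlayers
  · have h0 := hB.value_nonneg (fun p hp => mem_posPlayers.1 hp) (Sum.inl ⟨p, hp⟩)
    rw [← hAB] at h0
    simp only [withDummies, Sum.elim_inl] at h0
    obtain ⟨d, hd⟩ := hB.exists_dummy j
    have hr := (hB.swap (x := Sum.inl ⟨p, hp⟩) (y := Sum.inr d)
      (by simp only [withDummies, Sum.elim_inl, Sum.elim_inr, ← hAB]; linarith)
      (by simp only [withDummies, Sum.elim_inl, Sum.elim_inr, hd]; linarith)).2.2 (by simp)
    rw [← hAB, hd] at hr
    have hr' : I.rank p (A p) + (I.withDummies I.posPlayers).rank (Sum.inr d) j ≤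
      I.rank p j + (I.withDummies I.posPlayers).rank (Sum.inr d) (A p) := hr
    have hd1 := (I.withDummies I.posPlayers).rank_le_of_pref (p := Sum.inr d) (i := A p) (j := j)
      trivial
    have := I.rank_lt_of_strictPref hb
    omega
  · rw [← notMem_negPlayers, not_not, mem_negPlayers] at hp
    linarith [hp j]

end DoubleRoundRobin

end Instance

/-! ### The auction algorithm for the assignment problem

Rows bid for columns: `c r p` is the cost of assigning row `r` to column `p`, and `y p` is the
price of column `p`. The owner of a column is stored as the number of its row plus one; `0` stands
for a column without an owner. The row `r` is the one that bids next. -/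

/-- `k` rows are assigned and `C` bounds the costs. `slack` is complementary slackness up to the bid
increment 1. Rows enter in numerical order, so all owners are among the rows `0, …, k`, except for
the bidder `r`. -/
structure AuctionInv (N C : ℕ) (c : ℕ → ℕ → ℕ) (own y : ℕ → ℕ) (k r : ℕ) : Prop where
  own_le : ∀ p < N, own p ≤ N
  inj : ∀ p < N, ∀ p' < N, own p ≠ 0 → own p = own p' → p = p'
  price : ∀ p < N, own p = 0 → y p = 0
  slack : ∀ p < N, ∀ i, own p = i + 1 → ∀ p' < N, c i p + y p ≤ c i p' + y p' + 1
  card : ((Finset.range N).filter fun p => own p ≠ 0).card = k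
  price_le : ∀ p < N, y p ≤ C + 1
  cur : ∀ p < N, own p ≠ r + 1
  own_le' : ∀ p < N, own p ≤ k + 1
  le : r ≤ k

namespace AuctionInv

variable {N C : ℕ} {c : ℕ → ℕ → ℕ} {own y own' y' : ℕ → ℕ} {k r best : ℕ}

theorem init (hown : ∀ p < N, own p = 0) (hy : ∀ p < N, y p = 0) :
    AuctionInv N C c own y 0 0 where
  own_le p hp := by simp [hown p hp]
  inj p hp p' hp' h := absurd (hown p hp) h
  price p hp _ := hy p hp
  slack p hp i h := by simp [hown p hp] at h
  card := by
    rw [Finset.card_eq_zero, Finset.filter_eq_empty_iff]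
    intro p hp
    simpa using hown p (Finset.mem_range.1 hp)
  price_le p hp := by simp [hy p hp]
  cur p hp := by simp [hown p hp]
  own_le' p hp := by simp [hown p hp]
  le := le_rfl

theorem card_le (h : AuctionInv N C c own y k r) : k ≤ N := by
  rw [← h.card]
  simpa using Finset.card_filter_le (Finset.range N) fun p => own p ≠ 0

/-- While a row is unassigned, some column is unowned and has price 0, so the bidder's cheapest
total is at most `C`. -/
theorem bid_price_le (h : AuctionInv N C c own y k r) (hC : ∀ i < N, ∀ p < N, c i p ≤ C)
    (hk : k < N) (hmin : ∀ p < N, c r best + y best ≤ c r p + y p) : y best ≤ C := by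
  obtain ⟨p, hp, hp0⟩ : ∃ p < N, own p = 0 := by
    by_contra! hne
    have := h.card
    rw [Finset.filter_true_of_mem (by simpa using hne), Finset.card_range] at this
    omega
  have h1 := hmin p hp
  have h2 := hC r (h.le.trans_lt hk) p hp
  rw [h.price p hp hp0] at h1
  omega

/-- Prices only rise, which preserves `slack` for the remaining owners, and the bidder's column was
cheapest before it rose by one. A free column lets the next new row bid; otherwise the displaced
owner does. -/
theorem bid (h : AuctionInv N C c own y k r) (hC : ∀ i < N, ∀ p < N, c i p ≤ C)
    (hk : k < N) (hb : best < N) (hmin : ∀ p < N, c r best + y best ≤ c r p + y p)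
    (hown : ∀ p, own' p = if p = best then r + 1 else own p)
    (hy : ∀ p, y' p = if p = best then y best + 1 else y p) :
    (own best = 0 → AuctionInv N C c own' y' (k + 1) (k + 1)) ∧
      (own best ≠ 0 → AuctionInv N C c own' y' k (own best - 1)) := by
  have hr := h.le
  have hyb := h.bid_price_le hC hk hmin
  have h1 : ∀ p < N, own' p ≤ N := fun p hp => by
    rw [hown]; split_ifs
    · omega
    · exact h.own_le p hp
  have h2 : ∀ p < N, ∀ p' < N, own' p ≠ 0 → own' p = own' p' → p = p' := by
    intro p hp p' hp' h0 he
    rw [hown] at h0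
    rw [hown, hown] at he
    split_ifs at h0 he with ha hb hb
    · rw [ha, hb]
    · exact absurd he.symm (h.cur p' hp')
    · exact absurd he (h.cur p hp)
    · exact h.inj p hp p' hp' h0 he
  have h3 : ∀ p < N, own' p = 0 → y' p = 0 := by
    intro p hp h0
    rw [hown] at h0
    rw [hy]
    split_ifs at h0 with ha
    rw [if_neg ha]
    exact h.price p hp h0
  have h4 : ∀ p < N, ∀ i, own' p = i + 1 → ∀ p' < N, c i p + y' p ≤ c i p' + y' p' + 1 := by
    intro p hp i hi p' hp'
    have hmono : y p' ≤ y' p' := by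
      rw [hy]; split_ifs with ha
      · rw [ha]; omega
      · exact le_rfl
    rw [hown] at hi
    rw [hy p]
    split_ifs at hi ⊢ with ha
    · obtain rfl : r = i := by omega
      have := hmin p' hp'
      rw [ha]; omega
    · have := h.slack p hp i hi p' hp'
      omega
  have h5 : ∀ p < N, y' p ≤ C + 1 := by
    intro p hp
    rw [hy]; split_ifs
    · omega
    · exact h.price_le p hp
  constructor
  · intro h0
    refine ⟨h1, h2, h3, h4, ?_, h5, fun p hp => ?_, fun p hp => ?_, le_rfl⟩
    · have : ((Finset.range N).filter fun p => own' p ≠ 0) =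
          insert best ((Finset.range N).filter fun p => own p ≠ 0) := by
        ext p
        simp only [Finset.mem_filter, Finset.mem_range, Finset.mem_insert, hown]
        split_ifs with ha
        · simp [ha, hb]
        · simp [ha]
      rw [this, Finset.card_insert_of_notMem (by simp [h0]), h.card]
    · rw [hown]; split_ifs
      · omega
      · have := h.own_le' p hp; omega
    · rw [hown]; split_ifs
      · omega
      · have := h.own_le' p hp; omega
  · intro h0
    refine ⟨h1, h2, h3, h4, ?_, h5, fun p hp => ?_, fun p hp => ?_, ?_⟩
    · rw [← h.card]
      congr 1
      refine Finset.filter_congr fun p _ => ?_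
      rw [hown]; split_ifs with ha
      · simp [ha, h0]
      · rfl
    · rw [hown]; split_ifs with ha
      · have := h.cur best hb; omega
      · intro he
        exact ha (h.inj p hp best hb (by omega) (by omega))
    · rw [hown]; split_ifs
      · omega
      · exact h.own_le' p hp
    · have := h.own_le' best hb; omega

theorem sum_price_le (h : AuctionInv N C c own y k r) :
    ∑ p ∈ Finset.range N, y p ≤ N * (C + 1) := by
  simpa using Finset.sum_le_card_nsmul (Finset.range N) y (C + 1)
    fun p hp => h.price_le p (Finset.mem_range.1 hp)

/-- The sum of the prices is the progress measure: together with `sum_price_le` it limits the number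
of bids. -/
theorem sum_bid (hb : best < N) (hy : ∀ p, y' p = if p = best then y best + 1 else y p) :
    ∑ p ∈ Finset.range N, y' p = ∑ p ∈ Finset.range N, y p + 1 := by
  have hb' : best ∈ Finset.range N := Finset.mem_range.2 hb
  rw [← Finset.add_sum_erase _ _ hb', ← Finset.add_sum_erase _ y hb', hy, if_pos rfl]
  have : ∑ p ∈ (Finset.range N).erase best, y' p = ∑ p ∈ (Finset.range N).erase best, y p :=
    Finset.sum_congr rfl fun p hp => by rw [hy, if_neg (Finset.ne_of_mem_erase hp)]
  omega

/-- When all rows are assigned, the assignment is optimal up to `N`. -/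
theorem exists_perm (h : AuctionInv N C c own y N r) :
    ∃ ρ : Equiv.Perm (Fin N), (∀ p : Fin N, own p = ρ p + 1) ∧
      ∀ ρ' : Equiv.Perm (Fin N), ∑ p, c (ρ p) p ≤ ∑ p, c (ρ' p) p + N := by
  have hne : ∀ p < N, own p ≠ 0 := by
    have := (Finset.filter_card_eq (by rw [h.card, Finset.card_range]) :
      ∀ p ∈ Finset.range N, own p ≠ 0)
    simpa using this
  let f : Fin N → Fin N := fun p => ⟨own p - 1, by
    have := hne p p.2; have := h.own_le p p.2; omega⟩
  have hf : ∀ p : Fin N, own p = f p + 1 := fun p => by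
    have := hne p p.2
    simp only [f]
    omega
  have hinj : Function.Injective f := fun p p' hpp =>
    Fin.ext (h.inj p p.2 p' p'.2 (hne p p.2) (by rw [hf, hf, hpp]))
  let ρ : Equiv.Perm (Fin N) := Equiv.ofBijective f (Finite.injective_iff_bijective.1 hinj)
  have hρ : ∀ p : Fin N, own p = ρ p + 1 := hf
  refine ⟨ρ, hρ, fun ρ' => ?_⟩
  -- Compare the column `p` of each row with the column that `ρ'` gives to the same row. Summed up,
  -- the prices cancel and the slack totals `N`.
  have hsum : ∑ p, (c (ρ p) p + y p) ≤
      ∑ p, (c (ρ p) ((ρ.trans ρ'.symm) p) + y ((ρ.trans ρ'.symm) p) + 1) :=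
    Finset.sum_le_sum fun p _ => h.slack p p.2 _ (hρ p) _ ((ρ.trans ρ'.symm) p).2
  have hc : ∑ p, c (ρ p) ((ρ.trans ρ'.symm) p) = ∑ p, c (ρ' p) p := by
    rw [← (ρ.trans ρ'.symm).sum_comp fun p => c (ρ' p) p]
    simp
  have hy : ∑ p, y ((ρ.trans ρ'.symm) p) = ∑ p : Fin N, y p :=
    (ρ.trans ρ'.symm).sum_comp fun p : Fin N => y p
  rw [Finset.sum_add_distrib, Finset.sum_add_distrib, Finset.sum_add_distrib, hc, hy] at hsum
  simp only [Finset.sum_const, Finset.card_univ, Fintype.card_fin, smul_eq_mul, mul_one] at hsum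
  omega

end AuctionInv

/-- An assignment that is optimal up to `N` is optimal if the costs are multiples of `N + 1`. -/
theorem sum_le_of_approx {N : ℕ} {c d : ℕ → ℕ → ℕ} {ρ : Equiv.Perm (Fin N)}
    (hd : ∀ r < N, ∀ p < N, c r p = (N + 1) * d r p)
    (hρ : ∀ ρ' : Equiv.Perm (Fin N), ∑ p, c (ρ p) p ≤ ∑ p, c (ρ' p) p + N)
    (ρ' : Equiv.Perm (Fin N)) : ∑ p, d (ρ p) p ≤ ∑ p, d (ρ' p) p := by
  have := hρ ρ'
  have e : ∀ σ : Equiv.Perm (Fin N), ∑ p, c (σ p) p = (N + 1) * ∑ p, d (σ p) p := fun σ => by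
    rw [Finset.mul_sum]
    exact Finset.sum_congr rfl fun p _ => hd _ (σ p).2 _ p.2
  rw [e, e] at this
  -- Unequal scaled costs differ by at least `N + 1`, more than the error `N`.
  by_contra! hlt
  nlinarith

/-! ### The stages of the lexicographic optimization -/

open Classical in
/-- The number of numbers below `k` that have the property `P`. -/
noncomputable def countBelow (k : ℕ) (P : ℕ → Prop) : ℕ := ((Finset.range k).filter P).card

theorem countBelow_zero (P : ℕ → Prop) : countBelow 0 P = 0 := by simp [countBelow]

theorem countBelow_succ_of_pos {k : ℕ} {P : ℕ → Prop} (h : P k) :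
    countBelow (k + 1) P = countBelow k P + 1 := by
  classical
  rw [countBelow, Finset.range_add_one, Finset.filter_insert, if_pos h,
    Finset.card_insert_of_notMem (by simp), countBelow]

theorem countBelow_succ_of_neg {k : ℕ} {P : ℕ → Prop} (h : ¬ P k) :
    countBelow (k + 1) P = countBelow k P := by
  classical
  rw [countBelow, Finset.range_add_one, Finset.filter_insert, if_neg h, countBelow]

theorem countBelow_le (k : ℕ) (P : ℕ → Prop) : countBelow k P ≤ k := by
  classical
  simpa [countBelow] using Finset.card_filter_le (Finset.range k) P

/-- The number of columns that are strictly better than `p` for the row `q`. -/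
noncomputable def betterCount (N : ℕ) (w : ℕ → ℕ → ℝ) (q p : ℕ) : ℕ :=
  countBelow N fun p' => w q p < w q p'

theorem betterCount_le (N : ℕ) (w : ℕ → ℕ → ℝ) (q p : ℕ) : betterCount N w q p ≤ N :=
  countBelow_le _ _

/-- The counts encode a row's real weights ordinally as small natural costs. If `p` beats `p'`, then
`p` itself is counted for `p'` but not for `p`, which needs `p < N`. -/
theorem betterCount_le_iff {N : ℕ} {w : ℕ → ℕ → ℝ} {q p p' : ℕ} (hp : p < N) :
    betterCount N w q p' ≤ betterCount N w q p ↔ w q p ≤ w q p' := by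
  classical
  simp only [betterCount, countBelow]
  constructor
  · intro h
    by_contra! hlt
    refine absurd h (not_le.2 (Finset.card_lt_card ((Finset.ssubset_iff_of_subset ?_).2
      ⟨p, ?_, ?_⟩)))
    · intro x hx
      rw [Finset.mem_filter] at hx ⊢
      exact ⟨hx.1, hlt.trans hx.2⟩
    · exact Finset.mem_filter.2 ⟨Finset.mem_range.2 hp, hlt⟩
    · simp
  · intro h
    refine Finset.card_le_card fun x hx => ?_
    rw [Finset.mem_filter] at hx ⊢
    exact ⟨hx.1, h.trans_lt hx.2⟩

/-- The first `q` rows have been optimized one after the other, `T r` is the weight that row `r`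
has got, and a column that gives row `r` less costs `(N + 1) * B`. -/
structure StageInv (N B : ℕ) (w : ℕ → ℕ → ℝ) (c : ℕ → ℕ → ℕ) (q : ℕ) (T : ℕ → ℝ) : Prop where
  done : ∀ r < q, ∀ p < N, (T r ≤ w r p → c r p = 0) ∧ (w r p < T r → c r p = (N + 1) * B)
  todo : ∀ r, q ≤ r → r < N → ∀ p < N, c r p = 0
  feasible : ∃ ρ : Equiv.Perm (Fin N), ∀ p, (ρ p : ℕ) < q → T (ρ p) ≤ w (ρ p) p
  optimal : ∀ (ρ : Equiv.Perm (Fin N)) (p₀ : Fin N), (ρ p₀ : ℕ) < q →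
    (∀ p, ρ p < ρ p₀ → T (ρ p) ≤ w (ρ p) p) → w (ρ p₀) p₀ ≤ T (ρ p₀)

namespace StageInv

variable {N B q : ℕ} {w : ℕ → ℕ → ℝ} {c c₁ c₂ : ℕ → ℕ → ℕ} {T : ℕ → ℝ}

theorem init (hc : ∀ r < N, ∀ p < N, c r p = 0) : StageInv N B w c 0 T where
  done _ hr := absurd hr (Nat.not_lt_zero _)
  todo r _ hr := hc r hr
  feasible := ⟨Equiv.refl _, fun _ hp => absurd hp (Nat.not_lt_zero _)⟩
  optimal _ _ hp := absurd hp (Nat.not_lt_zero _)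

theorem cost_le (h : StageInv N B w c q T) {r p : ℕ} (hr : r < N) (hp : p < N) :
    c r p ≤ (N + 1) * B := by
  by_cases hrq : r < q
  · rcases le_or_gt (T r) (w r p) with hT | hT
    · simp [(h.done r hrq p hp).1 hT]
    · exact ((h.done r hrq p hp).2 hT).le
  · simp [h.todo r (not_lt.1 hrq) hr p hp]

/-- With additional costs that cannot outweigh a penalty, an optimal assignment has no penalties
and is optimal for the additional costs among the assignments without penalties. -/
theorem approx_optimal (h : StageInv N B w c q T) {g : ℕ → ℕ → ℕ}
    (hg : ∀ ρ : Equiv.Perm (Fin N), ∑ p, g (ρ p) p < B)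
    (hc₁ : ∀ r < N, ∀ p < N, c₁ r p = c r p + (N + 1) * g r p) {ρ : Equiv.Perm (Fin N)}
    (hρ : ∀ ρ' : Equiv.Perm (Fin N), ∑ p, c₁ (ρ p) p ≤ ∑ p, c₁ (ρ' p) p + N) :
    (∀ p, (ρ p : ℕ) < q → T (ρ p) ≤ w (ρ p) p) ∧
      ∀ ρ' : Equiv.Perm (Fin N), (∀ p, (ρ' p : ℕ) < q → T (ρ' p) ≤ w (ρ' p) p) →
        ∑ p, g (ρ p) p ≤ ∑ p, g (ρ' p) p := by
  classical
  -- The cost `c₁` in units of `N + 1`.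
  let d : ℕ → ℕ → ℕ := fun r p => (if r < q ∧ w r p < T r then B else 0) + g r p
  have hd : ∀ r < N, ∀ p < N, c₁ r p = (N + 1) * d r p := by
    intro r hr p hp
    rw [hc₁ r hr p hp, mul_add]
    congr 1
    by_cases hrq : r < q
    · by_cases hT : w r p < T r
      · simp [hrq, hT, (h.done r hrq p hp).2 hT]
      · simp [hT, (h.done r hrq p hp).1 (not_lt.1 hT)]
    · simp [hrq, h.todo r (not_lt.1 hrq) hr p hp]
  have hle := sum_le_of_approx hd hρ
  have hfree : ∀ σ : Equiv.Perm (Fin N), (∀ p, (σ p : ℕ) < q → T (σ p) ≤ w (σ p) p) →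
      ∑ p, d (σ p) p = ∑ p, g (σ p) p := by
    intro σ hσ
    refine Finset.sum_congr rfl fun p _ => ?_
    simp only [d]
    rw [if_neg (fun hp => absurd (hσ p hp.1) (not_le.2 hp.2)), zero_add]
  have hfeas : ∀ p, (ρ p : ℕ) < q → T (ρ p) ≤ w (ρ p) p := by
    intro p hp
    -- A single penalty `B` already exceeds the whole cost of a penalty-free assignment.
    by_contra! hlt
    obtain ⟨τ, hτ⟩ := h.feasible
    have h1 := hle τ
    rw [hfree τ hτ] at h1
    have h2 : B ≤ d (ρ p) p := by simp [d, hp, hlt]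
    have h3 := Finset.single_le_sum (f := fun p : Fin N => d (ρ p) p)
      (fun _ _ => Nat.zero_le _) (Finset.mem_univ p)
    have h4 := hg τ
    omega
  refine ⟨hfeas, fun ρ' hρ' => ?_⟩
  have := hle ρ'
  rwa [hfree ρ hfeas, hfree ρ' hρ'] at this

/-- The extra cost concerns row `q` alone, so the optimum gives `q` the largest weight compatible
with the earlier targets. Comparing costs with that of `best` is comparing weights, so the new
penalties enforce this weight as the target of `q`. -/
theorem step (h : StageInv N B w c q T) (hq : q < N) (hB : N < B)
    (hc₁ : ∀ r < N, ∀ p < N, r ≠ q → c₁ r p = c r p)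
    (hc₁' : ∀ p < N, c₁ q p = (N + 1) * betterCount N w q p) {ρ : Equiv.Perm (Fin N)}
    (hρ : ∀ ρ' : Equiv.Perm (Fin N), ∑ p, c₁ (ρ p) p ≤ ∑ p, c₁ (ρ' p) p + N)
    (hc₂ : ∀ r < N, ∀ p < N, r ≠ q → c₂ r p = c₁ r p)
    {best : Fin N} (hbest : (ρ best : ℕ) = q)
    (hc₂' : ∀ p < N, c₂ q p = if c₁ q p ≤ c₁ q best then 0 else (N + 1) * B) :
    StageInv N B w c₂ (q + 1) fun r => if r = q then w q best else T r := by
  let g : ℕ → ℕ → ℕ := fun r p => if r = q then betterCount N w q p else 0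
  have hgsum : ∀ (σ : Equiv.Perm (Fin N)) (p : Fin N), (σ p : ℕ) = q →
      ∑ p, g (σ p) p = betterCount N w q p := by
    intro σ p hp
    rw [Finset.sum_eq_single p]
    · simp [g, hp]
    · intro p' _ hne
      simp only [g]
      rw [if_neg]
      intro he
      exact hne (σ.injective (Fin.ext (he.trans hp.symm)))
    · simp
  have hex : ∀ σ : Equiv.Perm (Fin N), ∃ p, (σ p : ℕ) = q := fun σ =>
    ⟨σ.symm ⟨q, hq⟩, by simp⟩
  obtain ⟨hfeas, hopt⟩ := h.approx_optimal (g := g) (c₁ := c₁) (fun σ => by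
      obtain ⟨p, hp⟩ := hex σ
      rw [hgsum σ p hp]
      exact (betterCount_le _ _ _ _).trans_lt hB) (fun r hr p hp => by
      by_cases hrq : r = q
      · subst hrq
        simp [g, hc₁' p hp, h.todo r le_rfl hr p hp]
      · simp [g, hrq, hc₁ r hr p hp hrq]) hρ
  refine ⟨fun r hr p hp => ?_, fun r hr hrN p hp => ?_, ⟨ρ, fun p hp => ?_⟩,
    fun σ p₀ hp₀ hσ => ?_⟩
  · by_cases hrq : r = q
    · subst hrq
      simp only [if_true]
      simp only [hc₂' p hp, hc₁' p hp, hc₁' best best.2,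
        Nat.mul_le_mul_left_iff (Nat.succ_pos N), betterCount_le_iff best.2]
      exact ⟨fun h => if_pos h, fun h => if_neg (not_le.2 h)⟩
    · simp only [hrq, if_false]
      rw [hc₂ r (by omega) p hp hrq, hc₁ r (by omega) p hp hrq]
      exact h.done r (by omega) p hp
  · rw [hc₂ r hrN p hp (by omega), hc₁ r hrN p hp (by omega)]
    exact h.todo r (by omega) hrN p hp
  · split_ifs with he
    · rw [he]
      have : p = best := ρ.injective (Fin.ext (he.trans hbest.symm))
      rw [this]
    · exact hfeas p (by omega)
  · split_ifs with he
    · rw [he]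
      have h1 := hopt σ fun p hp => by
        have := hσ p (by rw [Fin.lt_def]; omega)
        rwa [if_neg (by omega)] at this
      rw [hgsum σ p₀ he, hgsum ρ best hbest, betterCount_le_iff p₀.2] at h1
      exact h1
    · refine h.optimal σ p₀ (by omega) fun p hp => ?_
      have := hσ p hp
      rw [Fin.lt_def] at hp
      rwa [if_neg (by omega)] at this

/-- Every row gets exactly its target: at least by feasibility, at most by `optimal`. So matchings
with the same weights are penalty-free, and `g` is minimized among them. -/
theorem final (h : StageInv N B w c N T) {g : ℕ → ℕ → ℕ}
    (hg : ∀ ρ : Equiv.Perm (Fin N), ∑ p, g (ρ p) p < B)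
    (hc₁ : ∀ r < N, ∀ p < N, c₁ r p = c r p + (N + 1) * g r p) {ρ : Equiv.Perm (Fin N)}
    (hρ : ∀ ρ' : Equiv.Perm (Fin N), ∑ p, c₁ (ρ p) p ≤ ∑ p, c₁ (ρ' p) p + N) :
    (∀ (ν : Equiv.Perm (Fin N)) (q : Fin N),
      (∀ r < q, w r (ν r) = w r (ρ.symm r)) → w q (ν q) ≤ w q (ρ.symm q)) ∧
    ∀ ν : Equiv.Perm (Fin N), (∀ q : Fin N, w q (ν q) = w q (ρ.symm q)) →
      ∑ p, g (ρ p) p ≤ ∑ p, g (ν.symm p) p := by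
  obtain ⟨hfeas, hopt⟩ := h.approx_optimal hg hc₁ hρ
  have hT : ∀ r : Fin N, w r (ρ.symm r) = T r := fun r => by
    refine le_antisymm ?_ ?_
    · simpa using h.optimal ρ (ρ.symm r) (by simp) fun p _ => hfeas p (ρ p).2
    · simpa using hfeas (ρ.symm r) (by simp)
  constructor
  · intro ν q hν
    rw [hT]
    have := h.optimal ν.symm (ν q) (by simp) fun p hp => by
      obtain ⟨r, rfl⟩ := ν.surjective p
      simp only [Equiv.symm_apply_apply] at hp ⊢
      rw [hν r hp, hT]
    simpa using this
  · intro ν hν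
    refine hopt ν.symm fun p _ => ?_
    obtain ⟨r, rfl⟩ := ν.surjective p
    simp only [Equiv.symm_apply_apply]
    rw [hν r, hT]

end StageInv

/-! ### A program logic for the random access machine -/

@[simp] theorem Memory.setVar_var (s : Memory) (x v y : ℕ) :
    (s.setVar x v).var y = if y = x then v else s.var y := rfl

@[simp] theorem Memory.setVar_arr (s : Memory) (x v : ℕ) : (s.setVar x v).arr = s.arr := rfl

@[simp] theorem Memory.setArr_var (s : Memory) (a i j k v : ℕ) :
    (s.setArr a i j k v).var = s.var := rfl

theorem Memory.setArr_arr (s : Memory) (a i j k v a' i' j' k' : ℕ) :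
    (s.setArr a i j k v).arr a' i' j' k' =
      if a' = a ∧ i' = i ∧ j' = j ∧ k' = k then v else s.arr a' i' j' k' := rfl

theorem Memory.setArr_arr_of_ne (s : Memory) {a a' : ℕ} (h : a' ≠ a) (i j k v : ℕ) :
    (s.setArr a i j k v).arr a' = s.arr a' := by
  funext i' j' k'
  simp [Memory.setArr_arr, h]

namespace Prog

/-- Whether the program contains an assignment to the variable `x`. -/
def setsVar (x : ℕ) : Prog → Bool
  | skip => false
  | assign y _ => x == y
  | store _ _ _ _ _ => false
  | seq c d => setsVar x c || setsVar x d
  | ite _ c d => setsVar x c || setsVar x d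
  | loop _ c => setsVar x c

/-- Whether the program contains an assignment to the array `a`. -/
def setsArr (a : ℕ) : Prog → Bool
  | skip => false
  | assign _ _ => false
  | store b _ _ _ _ => a == b
  | seq c d => setsArr a c || setsArr a d
  | ite _ c d => setsArr a c || setsArr a d
  | loop _ c => setsArr a c

/-- A bound for the number of steps if every loop is repeated at most `X` times. -/
noncomputable def time : Prog → Polynomial ℕ
  | skip => 1
  | assign _ _ => 1
  | store _ _ _ _ _ => 1
  | seq c d => time c + time d
  | ite _ c d => 1 + time c + time d
  | loop _ c => Polynomial.X * (1 + time c) + 1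

/-- The loop that runs through all values of `x` that are smaller than `y`. -/
def forLoop (x y : ℕ) (c : Prog) : Prog :=
  seq (assign x (.const 0))
    (loop (.not (.le (.var y) (.var x))) (seq c (assign x (.add (.var x) (.const 1)))))

end Prog

/-- The memories `s` and `s'` differ only in what the program `c` assigns. -/
structure SameExcept (c : Prog) (s s' : Memory) : Prop where
  var : ∀ x, c.setsVar x = false → s'.var x = s.var x
  arr : ∀ a, c.setsArr a = false → s'.arr a = s.arr a

namespace SameExcept

theorem refl (c : Prog) (s : Memory) : SameExcept c s s := ⟨fun _ _ => rfl, fun _ _ => rfl⟩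

theorem trans {c : Prog} {s s' s'' : Memory} (h : SameExcept c s s') (h' : SameExcept c s' s'') :
    SameExcept c s s'' :=
  ⟨fun x hx => (h'.var x hx).trans (h.var x hx), fun a ha => (h'.arr a ha).trans (h.arr a ha)⟩

theorem of_sub {c d : Prog} {s s' : Memory} (h : SameExcept c s s')
    (hv : ∀ x, d.setsVar x = false → c.setsVar x = false)
    (ha : ∀ a, d.setsArr a = false → c.setsArr a = false) : SameExcept d s s' :=
  ⟨fun x hx => h.var x (hv x hx), fun a h' => h.arr a (ha a h')⟩

end SameExcept

theorem Exec.sameExcept {R : ℕ → ℕ → ℝ} {c : Prog} {s s' : Memory} {t : ℕ}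
    (h : Exec R c s t s') : SameExcept c s s' := by
  induction h with
  | skip s => exact SameExcept.refl _ s
  | assign s x e =>
    refine ⟨fun y hy => ?_, fun _ _ => rfl⟩
    have : y ≠ x := by simpa [Prog.setsVar] using hy
    simp [this]
  | store s a i j k e =>
    refine ⟨fun _ _ => rfl, fun b hb => ?_⟩
    have : b ≠ a := by simpa [Prog.setsArr] using hb
    exact s.setArr_arr_of_ne this _ _ _ _
  | seq _ _ h1 h2 =>
    exact (h1.of_sub (by simp +contextual [Prog.setsVar])
      (by simp +contextual [Prog.setsArr])).trans (h2.of_sub (by simp +contextual [Prog.setsVar])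
      (by simp +contextual [Prog.setsArr]))
  | ite_true _ _ h1 =>
    exact h1.of_sub (by simp +contextual [Prog.setsVar]) (by simp +contextual [Prog.setsArr])
  | ite_false _ _ h1 =>
    exact h1.of_sub (by simp +contextual [Prog.setsVar]) (by simp +contextual [Prog.setsArr])
  | loop_false _ => exact SameExcept.refl _ _
  | loop_true _ _ _ h1 h2 =>
    exact (h1.of_sub (by simp +contextual [Prog.setsVar])
      (by simp +contextual [Prog.setsArr])).trans h2

/-- Started in `s`, the program `c` halts in a memory with the property `Q`, within the time that
it takes if every loop is repeated at most `M` times. -/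
def Runs (R : ℕ → ℕ → ℝ) (M : ℕ) (c : Prog) (s : Memory) (Q : Memory → Prop) : Prop :=
  ∃ t s', Exec R c s t s' ∧ t ≤ c.time.eval M ∧ Q s'

namespace Runs

variable {R : ℕ → ℕ → ℝ} {M : ℕ} {c d : Prog} {s : Memory} {P Q : Memory → Prop}

/-- Handing over `SameExcept` acts as a frame rule: postconditions need only mention what the
program changes. -/
theorem mono (h : Runs R M c s P) (hPQ : ∀ s', SameExcept c s s' → P s' → Q s') :
    Runs R M c s Q := by
  obtain ⟨t, s', he, ht, hP⟩ := h
  exact ⟨t, s', he, ht, hPQ s' he.sameExcept hP⟩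

theorem skip (h : Q s) : Runs R M .skip s Q :=
  ⟨1, s, .skip s, by simp [Prog.time], h⟩

theorem assign {x : ℕ} {e : Expr} (h : Q (s.setVar x (e.eval s))) :
    Runs R M (.assign x e) s Q :=
  ⟨1, _, .assign s x e, by simp [Prog.time], h⟩

theorem store {a : ℕ} {i j k e : Expr}
    (h : Q (s.setArr a (i.eval s) (j.eval s) (k.eval s) (e.eval s))) :
    Runs R M (.store a i j k e) s Q :=
  ⟨1, _, .store s a i j k e, by simp [Prog.time], h⟩

theorem seq' (h : Runs R M c s fun s' => Runs R M d s' Q) : Runs R M (.seq c d) s Q := by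
  obtain ⟨t, s', he, ht, u, s'', he', hu, hQ⟩ := h
  exact ⟨t + u, s'', .seq he he', by simpa [Prog.time] using add_le_add ht hu, hQ⟩

theorem seq (h : Runs R M c s P)
    (h' : ∀ s', SameExcept c s s' → P s' → Runs R M d s' Q) : Runs R M (.seq c d) s Q :=
  seq' (h.mono h')

theorem ite {b : Test} (h : b.holds R s → Runs R M c s Q) (h' : ¬ b.holds R s → Runs R M d s Q) :
    Runs R M (.ite b c d) s Q := by
  by_cases hb : b.holds R s
  · obtain ⟨t, s', he, ht, hQ⟩ := h hb
    exact ⟨1 + t, s', .ite_true hb he, by simp [Prog.time]; omega, hQ⟩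
  · obtain ⟨t, s', he, ht, hQ⟩ := h' hb
    exact ⟨1 + t, s', .ite_false hb he, by simp [Prog.time]; omega, hQ⟩

/-- The variant `V` bounds the number of passes, and `M` bounds its initial value, as `time`
assumes. -/
theorem loop {b : Test} (Inv : Memory → Prop) (V : Memory → ℕ) (hs : Inv s) (hV : V s ≤ M)
    (hstep : ∀ s', SameExcept (.loop b c) s s' → Inv s' → b.holds R s' →
      Runs R M c s' fun s'' => Inv s'' ∧ V s'' < V s') :
    Runs R M (.loop b c) s fun s' => Inv s' ∧ ¬ b.holds R s' := by
  have key : ∀ v s', V s' ≤ v → Inv s' → SameExcept (.loop b c) s s' →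
      ∃ t s'', Exec R (.loop b c) s' t s'' ∧ t ≤ v * (1 + c.time.eval M) + 1 ∧
        Inv s'' ∧ ¬ b.holds R s'' := by
    intro v
    induction v with
    | zero =>
      intro s' hv hI hsame
      by_cases hb : b.holds R s'
      · obtain ⟨_, s'', _, _, _, hlt⟩ := hstep s' hsame hI hb
        omega
      · exact ⟨1, s', .loop_false hb, by omega, hI, hb⟩
    | succ v ih =>
      intro s' hv hI hsame
      by_cases hb : b.holds R s'
      · obtain ⟨t, s'', he, ht, hI', hlt⟩ := hstep s' hsame hI hb
        obtain ⟨u, s₃, he', hu, hfin⟩ := ih s'' (by omega) hI'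
          (hsame.trans (he.sameExcept.of_sub (fun _ h => h) (fun _ h => h)))
        exact ⟨1 + t + u, s₃, .loop_true hb he he', by rw [add_mul]; omega, hfin⟩
      · exact ⟨1, s', .loop_false hb, by omega, hI, hb⟩
  obtain ⟨t, s', he, ht, hfin⟩ := key M s hV hs (SameExcept.refl _ _)
  exact ⟨t, s', he, by simpa [Prog.time] using ht, hfin⟩

/-- The body may touch neither the counter nor the bound, so there are exactly `k` passes. The
invariant is stated for the memory with the counter already advanced. -/
theorem forLoop {x y k : ℕ} (hk : s.var y = k) (hkM : k ≤ M) (Inv : ℕ → Memory → Prop)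
    (hxy : x ≠ y) (hx : c.setsVar x = false) (hy : c.setsVar y = false)
    (h0 : Inv 0 (s.setVar x 0))
    (hstep : ∀ i < k, ∀ s', s'.var x = i → SameExcept (.forLoop x y c) s s' → Inv i s' →
      Runs R M c s' fun s'' => Inv (i + 1) (s''.setVar x (i + 1))) :
    Runs R M (.forLoop x y c) s (Inv k) := by
  refine seq' (assign ?_)
  have hfor : ∀ z, (Prog.forLoop x y c).setsVar z = false ↔ z ≠ x ∧ c.setsVar z = false := by
    intro z
    simp only [Prog.forLoop, Prog.setsVar, Bool.or_eq_false_iff, beq_eq_false_iff_ne]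
    tauto
  have hfor' : ∀ a, (Prog.forLoop x y c).setsArr a = c.setsArr a := by
    intro a
    simp [Prog.forLoop, Prog.setsArr]
  refine (loop (fun s' => s'.var y = k ∧ s'.var x ≤ k ∧ Inv (s'.var x) s')
    (fun s' => k - s'.var x) ?_ ?_ ?_).mono ?_
  · simpa [Expr.eval, hxy.symm, hk] using h0
  · simpa [Expr.eval] using hkM
  · rintro s' hs' ⟨hy', hle, hI⟩ hb
    have hlt : s'.var x < k := by simpa [Test.holds, Expr.eval, hy'] using hb
    refine seq (hstep _ hlt s' rfl ⟨fun z hz => ?_, fun a ha => ?_⟩ hI) fun s'' h2 hI' => ?_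
    · rw [hfor] at hz
      rw [hs'.var z (by simp [Prog.setsVar, hz])]
      simp [hz.1]
    · rw [hfor'] at ha
      rw [hs'.arr a (by simpa [Prog.setsArr] using ha)]
      rfl
    · refine assign ?_
      have e : (Expr.add (.var x) (.const 1)).eval s'' = s'.var x + 1 := by
        simp [Expr.eval, h2.var x hx]
      rw [e]
      refine ⟨⟨?_, ?_, ?_⟩, ?_⟩
      · simp [hxy.symm, h2.var y hy, hy']
      · simpa using hlt
      · simpa using hI'
      · simp only [Memory.setVar_var, if_true]
        omega
  · rintro s' - ⟨⟨hy', hle, hI⟩, hb⟩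
    have : k ≤ s'.var x := by simpa [Test.holds, Expr.eval, hy'] using hb
    rwa [show s'.var x = k by omega] at hI

end Runs

/-! ### The program

Variables: `0` number of teams, `1` number of players, `2` number of positions, `3` number of
players in the current part, `4` number of rounds, `5` current stage, `6` row, `7` and `8` columns,
`9` team, `10` best column, `11` number of assigned rows, `12` bidding row, `13` former owner, `14`
threshold, `15` penalty, `16` flag, `17` cost unit.

Arrays: `0` preferences, `1` output, `2` player of a column, `3` team of a row, `4` costs, `5`
owners of the columns, `6` prices of the columns. -/

namespace Prog

/-- The entry `i` of the one-dimensional array `a`. -/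
def cell (a : ℕ) (i : Expr) : Expr := .arr a i (.const 0) (.const 0)

/-- Overwrite the entry `i` of the one-dimensional array `a`. -/
def storeCell (a : ℕ) (i e : Expr) : Prog := store a i (.const 0) (.const 0) e

/-- The cost of column `y` for row `x`. -/
def cost (x y : ℕ) : Expr := .arr 4 (.var x) (.var y) (.const 0)

/-- Overwrite the cost of column `y` for row `x`. -/
def storeCost (x y : ℕ) (e : Expr) : Prog := store 4 (.var x) (.var y) (.const 0) e

/-- Find the column that minimizes the sum of cost and price for the bidding row. -/
def findBest : Prog :=
  seq (assign 10 (.const 0))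
    (forLoop 7 2
      (ite (.le (.add (cost 12 7) (cell 6 (.var 7))) (.add (cost 12 10) (cell 6 (.var 10))))
        (assign 10 (.var 7)) skip))

/-- The bidding row gets the best column, whose former owner bids next. -/
def placeBid : Prog :=
  seq (assign 13 (cell 5 (.var 10)))
  (seq (storeCell 5 (.var 10) (.add (.var 12) (.const 1)))
  (seq (storeCell 6 (.var 10) (.add (cell 6 (.var 10)) (.const 1)))
  (ite (.le (.var 13) (.const 0))
    (seq (assign 11 (.add (.var 11) (.const 1))) (assign 12 (.var 11)))
    (assign 12 (.sub (.var 13) (.const 1))))))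

/-- The auction algorithm. -/
def auction : Prog :=
  seq (forLoop 7 2 (seq (storeCell 5 (.var 7) (.const 0)) (storeCell 6 (.var 7) (.const 0))))
  (seq (assign 11 (.const 0))
  (seq (assign 12 (.const 0))
  (loop (.not (.le (.var 2) (.var 11))) (seq findBest placeBid))))

/-- Run through the values of `z` below `u` and increase the cost of column `y` for row `x` by one
unit whenever `b` holds. -/
def countCost (x y z u : ℕ) (b : Test) : Prog :=
  forLoop z u (ite b (storeCost x y (.add (cost x y) (.var 17))) skip)

/-- Make the cost of a column for row `5` the number of better columns. -/
def countBetter : Prog :=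
  forLoop 7 2 (countCost 5 7 8 2
    (.not (.tableLe (cell 3 (.var 5)) (cell 2 (.var 8)) (cell 3 (.var 5)) (cell 2 (.var 7)))))

/-- Find the cost of the column that row `5` has got. -/
def findThreshold : Prog :=
  forLoop 7 2
    (ite (.and (.le (cell 5 (.var 7)) (.add (.var 5) (.const 1)))
        (.le (.add (.var 5) (.const 1)) (cell 5 (.var 7))))
      (assign 14 (cost 5 7)) skip)

/-- Penalize the columns that are worse for row `5` than the one that it has got. -/
def penalize : Prog :=
  forLoop 7 2 (ite (.le (cost 5 7) (.var 14)) (storeCost 5 7 (.const 0))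
    (storeCost 5 7 (.var 15)))

/-- One row after the other gets the best possible column. -/
def stages : Prog :=
  forLoop 5 2 (seq countBetter (seq auction (seq findThreshold penalize)))

/-- Compute the cost unit and the penalty. -/
def computePenalty : Prog :=
  seq (assign 17 (.add (.var 2) (.const 1)))
  (seq (assign 15 (.var 17))
  (forLoop 6 2 (forLoop 7 2 (assign 15 (.add (.var 15) (.var 17))))))

/-- Set all costs to zero. -/
def clearCosts : Prog := forLoop 6 2 (forLoop 7 2 (storeCost 6 7 (.const 0)))

/-- Add the ranks to the costs. -/
def addRanks : Prog :=
  forLoop 6 2 (forLoop 7 2 (countCost 6 7 9 0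
    (.and (.le (.const 1) (.arr 0 (cell 2 (.var 7)) (.var 9) (cell 3 (.var 6))))
      (.not (.le (.const 1) (.arr 0 (cell 2 (.var 7)) (cell 3 (.var 6)) (.var 9)))))))

/-- The matching of the round-robin algorithm. -/
def solve : Prog :=
  seq computePenalty (seq clearCosts (seq stages (seq addRanks auction)))

/-- Collect the players for whom `b` holds, where the flag tells whether some team assigns a
nonnegative value to the player. -/
def collect (b : Test) : Prog :=
  seq (assign 3 (.const 0))
  (forLoop 7 1
    (seq (assign 16 (.const 0))
    (seq (forLoop 9 0
      (ite (.tableLe (.const 0) (.var 1) (.var 9) (.var 7)) (assign 16 (.const 1)) skip))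
    (ite b (seq (storeCell 2 (.var 3) (.var 7)) (assign 3 (.add (.var 3) (.const 1)))) skip))))

/-- Compute the number of positions and the team of each position, where `e` is the team that
comes next if the variable `9` is its place in the order. -/
def computeTurns (e : Expr) : Prog :=
  seq (assign 4 (.add (.var 3) (.const 1)))
  (seq (assign 2 (.const 0))
  (forLoop 6 4 (forLoop 9 0
    (seq (storeCell 3 (.var 2) e) (assign 2 (.add (.var 2) (.const 1)))))))

/-- Let the dummies be the remaining columns. -/
def addDummies : Prog :=
  forLoop 7 2 (ite (.le (.var 3) (.var 7)) (storeCell 2 (.var 7) (.var 1)) skip)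

/-- Write the teams of the collected players to the output. -/
def writeTeams : Prog :=
  forLoop 7 3
    (storeCell 1 (cell 2 (.var 7)) (cell 3 (.sub (cell 5 (.var 7)) (.const 1))))

/-- The round-robin algorithm on the players for whom `b` holds. -/
def roundRobin (b : Test) (e : Expr) : Prog :=
  seq (collect b) (seq (computeTurns e) (seq addDummies (seq solve writeTeams)))

/-- The double round-robin algorithm. -/
def doubleRoundRobin : Prog :=
  seq (roundRobin (.le (.const 1) (.var 16)) (.var 9))
    (roundRobin (.le (.var 16) (.const 0)) (.sub (.sub (.var 0) (.const 1)) (.var 9)))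

end Prog

/-! ### Correctness and running time of the subroutines -/

namespace Prog

variable {R : ℕ → ℕ → ℝ} {M N : ℕ} {s : Memory}

theorem runs_findBest (hN : s.var 2 = N) (h0 : 0 < N) (hM : N ≤ M) :
    Runs R M findBest s fun s' => s'.var 10 < N ∧ ∀ p < N,
      s.arr 4 (s.var 12) (s'.var 10) 0 + s.arr 6 (s'.var 10) 0 0 ≤
        s.arr 4 (s.var 12) p 0 + s.arr 6 p 0 0 := by
  refine Runs.seq' (Runs.assign (Runs.forLoop (k := N) (by simpa using hN) hM
    (fun i s' => s'.var 10 < N ∧ ∀ p < i,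
      s.arr 4 (s.var 12) (s'.var 10) 0 + s.arr 6 (s'.var 10) 0 0 ≤
        s.arr 4 (s.var 12) p 0 + s.arr 6 p 0 0) (by decide) rfl rfl ?_ ?_))
  · simpa [Expr.eval] using h0
  · rintro i hi s' hx hs' ⟨hb, hmin⟩
    have e4 : s'.arr 4 = s.arr 4 := hs'.arr 4 rfl
    have e6 : s'.arr 6 = s.arr 6 := hs'.arr 6 rfl
    have e12 : s'.var 12 = s.var 12 := hs'.var 12 rfl
    refine Runs.ite (fun hc => Runs.assign ?_) (fun hc => Runs.skip ?_) <;>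
      simp only [Test.holds, Expr.eval, cost, cell, e4, e6, e12, hx] at hc
    · simp only [Expr.eval, hx, Memory.setVar_var]
      refine ⟨by simpa using hi, fun p hp => ?_⟩
      simp only [if_true, if_false, Nat.reduceEqDiff]
      rcases Nat.lt_succ_iff_lt_or_eq.1 hp with hp | rfl
      · exact hc.trans (hmin p hp)
      · exact le_rfl
    · simp only [Memory.setVar_var]
      refine ⟨by simpa using hb, fun p hp => ?_⟩
      simp only [if_false, Nat.reduceEqDiff]
      rcases Nat.lt_succ_iff_lt_or_eq.1 hp with hp | rfl
      · exact hmin p hp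
      · exact (not_le.1 hc).le

theorem runs_placeBid : Runs R M placeBid s fun s' =>
    (∀ p, s'.arr 5 p 0 0 = if p = s.var 10 then s.var 12 + 1 else s.arr 5 p 0 0) ∧
    (∀ p, s'.arr 6 p 0 0 = if p = s.var 10 then s.arr 6 (s.var 10) 0 0 + 1
      else s.arr 6 p 0 0) ∧
    (s.arr 5 (s.var 10) 0 0 = 0 → s'.var 11 = s.var 11 + 1 ∧ s'.var 12 = s.var 11 + 1) ∧
    (s.arr 5 (s.var 10) 0 0 ≠ 0 →
      s'.var 11 = s.var 11 ∧ s'.var 12 = s.arr 5 (s.var 10) 0 0 - 1) := by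
  refine Runs.seq' (Runs.assign (Runs.seq' (Runs.store (Runs.seq' (Runs.store (Runs.ite
    (fun hc => Runs.seq' (Runs.assign (Runs.assign ?_))) (fun hc => Runs.assign ?_)))))))
  all_goals
    simp only [Test.holds, Expr.eval, cell, Memory.setVar_var, Memory.setArr_var,
      Memory.setArr_arr, Memory.setVar_arr] at hc ⊢
    simp at hc
    simp [hc]

theorem runs_auction {C : ℕ} (hN : s.var 2 = N)
    (hC : ∀ r < N, ∀ p < N, s.arr 4 r p 0 ≤ C) (hM : N * (C + 1) ≤ M) :
    Runs R M auction s fun s' => ∃ ρ : Equiv.Perm (Fin N),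
      (∀ p : Fin N, s'.arr 5 p 0 0 = ρ p + 1) ∧
      ∀ ρ' : Equiv.Perm (Fin N),
        ∑ p, s.arr 4 (ρ p) p 0 ≤ ∑ p, s.arr 4 (ρ' p) p 0 + N := by
  have hNM : N ≤ M := le_trans (Nat.le_mul_of_pos_right N (Nat.succ_pos C)) hM
  refine Runs.seq (Runs.forLoop (k := N) hN hNM
    (fun i s' => ∀ p < i, s'.arr 5 p 0 0 = 0 ∧ s'.arr 6 p 0 0 = 0) (by decide) rfl rfl
    (by simp) ?_) fun s₁ h₁ hI₁ => Runs.seq' (Runs.assign (Runs.seq' (Runs.assign ?_)))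
  · intro i hi s' hx hs' hI
    refine Runs.seq' (Runs.store (Runs.store fun p hp => ?_))
    simp only [Expr.eval, hx, Memory.setVar_arr, Memory.setArr_arr, Memory.setArr_var]
    rcases Nat.lt_succ_iff_lt_or_eq.1 hp with hp | rfl
    · simp [hp.ne, hI p hp]
    · simp
  have e4 : s₁.arr 4 = s.arr 4 := h₁.arr 4 rfl
  have e2 : s₁.var 2 = N := (h₁.var 2 rfl).trans hN
  refine (Runs.loop (fun s' => AuctionInv N C (fun r p => s.arr 4 r p 0)
    (fun p => s'.arr 5 p 0 0) (fun p => s'.arr 6 p 0 0) (s'.var 11) (s'.var 12))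
    -- The distance of the price sum from its upper bound drops with each bid.
    (fun s' => N * (C + 1) - ∑ p ∈ Finset.range N, s'.arr 6 p 0 0) ?_ ?_ ?_).mono ?_
  · exact AuctionInv.init (fun p hp => (hI₁ p hp).1) (fun p hp => (hI₁ p hp).2)
  · exact (Nat.sub_le _ _).trans hM
  · intro s₂ h₂ hI hb
    have e4' : s₂.arr 4 = s.arr 4 := (h₂.arr 4 rfl).trans e4
    have e2' : s₂.var 2 = N := (h₂.var 2 rfl).trans e2
    have hlt : s₂.var 11 < N := by simpa [Test.holds, Expr.eval, e2'] using hb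
    refine Runs.seq (runs_findBest e2' (by omega) hNM) fun s₃ h₃ ⟨hbest, hmin⟩ => ?_
    have e5 : s₃.arr 5 = s₂.arr 5 := h₃.arr 5 rfl
    have e6 : s₃.arr 6 = s₂.arr 6 := h₃.arr 6 rfl
    have e11 : s₃.var 11 = s₂.var 11 := h₃.var 11 rfl
    have e12 : s₃.var 12 = s₂.var 12 := h₃.var 12 rfl
    refine runs_placeBid.mono fun s₄ h₄ ⟨hown, hy, hnew, hold⟩ => ?_
    rw [e4'] at hmin
    rw [e11, e5] at hnew hold
    simp only [e5, e6, e12] at hown hy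
    obtain ⟨c1, c2⟩ := hI.bid hC hlt hbest hmin hown hy
    have hI' : AuctionInv N C (fun r p => s.arr 4 r p 0)
        (fun p => s₄.arr 5 p 0 0) (fun p => s₄.arr 6 p 0 0) (s₄.var 11) (s₄.var 12) := by
      by_cases h0 : s₂.arr 5 (s₃.var 10) 0 0 = 0
      · rw [(hnew h0).1, (hnew h0).2]
        exact c1 h0
      · rw [(hold h0).1, (hold h0).2]
        exact c2 h0
    refine ⟨hI', ?_⟩
    have h5 := hI'.sum_price_le
    have h6 := AuctionInv.sum_bid hbest hy
    omega
  · rintro s₂ h₂ ⟨hI, hb⟩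
    have e2' : s₂.var 2 = N := (h₂.var 2 rfl).trans e2
    have hle : N ≤ s₂.var 11 := by simpa [Test.holds, Expr.eval, e2'] using hb
    rw [le_antisymm hI.card_le hle] at hI
    exact hI.exists_perm

/-- The test may read the memory, so `hb` is required in every memory that differs from `s` only in
what the loop assigns. -/
theorem runs_countCost {x y z u k : ℕ} {b : Test} (hx : x ≠ z) (hy : y ≠ z) (hz : 17 ≠ z)
    (hu : z ≠ u) (hk : s.var u = k) (hM : k ≤ M) {P : ℕ → Prop}
    (hb : ∀ l < k, ∀ s', s'.var z = l → SameExcept (countCost x y z u b) s s' →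
      (b.holds R s' ↔ P l)) :
    Runs R M (countCost x y z u b) s fun s' => ∀ i j, s'.arr 4 i j 0 = s.arr 4 i j 0 +
      if i = s.var x ∧ j = s.var y then s.var 17 * countBelow k P else 0 := by
  have hset : ∀ v, v ≠ z → (countCost x y z u b).setsVar v = false := fun v hv => by
    simp [countCost, forLoop, setsVar, storeCost, hv]
  refine Runs.forLoop hk hM (fun l s' => ∀ i j, s'.arr 4 i j 0 = s.arr 4 i j 0 +
    if i = s.var x ∧ j = s.var y then s.var 17 * countBelow l P else 0) hu rfl rfl
    (by simp [countBelow_zero]) ?_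
  intro l hl s' hz' hs' hI
  have ex := hs'.var x (hset x hx)
  have ey := hs'.var y (hset y hy)
  have e17 := hs'.var 17 (hset 17 hz)
  refine Runs.ite (fun hc => Runs.store ?_) (fun hc => Runs.skip ?_) <;>
    rw [hb l hl s' hz' hs'] at hc
  · intro i j
    simp only [Expr.eval, cost, Memory.setVar_arr, Memory.setArr_arr, ex, ey, e17, hI,
      countBelow_succ_of_pos hc]
    by_cases hij : i = s.var x ∧ j = s.var y
    · simp [hij, mul_add, add_assoc]
    · simp [hij]
  · intro i j
    simp only [Memory.setVar_arr, hI, countBelow_succ_of_neg hc]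

/-- The weights in terms of the memory. -/
def weightIn (R : ℕ → ℕ → ℝ) (s : Memory) (q p : ℕ) : ℝ := R (s.arr 3 q 0 0) (s.arr 2 p 0 0)

/-- The ranks, minus one, in terms of the memory. -/
noncomputable def rankIn (s : Memory) (q p : ℕ) : ℕ :=
  countBelow (s.var 0) fun i => 1 ≤ s.arr 0 (s.arr 2 p 0 0) i (s.arr 3 q 0 0) ∧
    ¬ 1 ≤ s.arr 0 (s.arr 2 p 0 0) (s.arr 3 q 0 0) i

theorem runs_countBetter (hN : s.var 2 = N) (hM : N ≤ M) :
    Runs R M countBetter s fun s' => ∀ r, ∀ p < N, s'.arr 4 r p 0 = s.arr 4 r p 0 +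
      if r = s.var 5 then s.var 17 * betterCount N (weightIn R s) r p else 0 := by
  refine (Runs.forLoop hN hM (fun i s' => ∀ r p, s'.arr 4 r p 0 = s.arr 4 r p 0 +
    if r = s.var 5 ∧ p < i then s.var 17 * betterCount N (weightIn R s) r p else 0)
    (by decide) rfl rfl (by simp) ?_).mono fun s' _ h r p hp => by simp [h r p, hp]
  intro i hi s₁ hx h₁ hI
  refine (runs_countCost (P := fun p' => weightIn R s (s.var 5) i < weightIn R s (s.var 5) p')
    (by decide) (by decide) (by decide) (by decide) ((h₁.var 2 rfl).trans hN) hM ?_).mono ?_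
  · intro l hl s₂ hl' h₂
    simp only [Test.holds, Expr.eval, cell, hl', h₂.arr 3 rfl, h₂.arr 2 rfl, h₁.arr 3 rfl,
      h₁.arr 2 rfl, h₂.var 5 rfl, h₂.var 7 rfl, h₁.var 5 rfl, hx, not_le, weightIn]
  · intro s₂ h₂ hc r p
    simp only [Memory.setVar_arr, hc r p, hI r p, h₁.var 5 rfl, hx, h₁.var 17 rfl]
    by_cases hr : r = s.var 5
    · subst hr
      rcases lt_trichotomy p i with hp | rfl | hp
      · simp [hp, hp.ne, Nat.lt_succ_of_lt hp]
      · simp [betterCount]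
      · have : ¬ p < i + 1 := by omega
        simp [hp.ne', hp.le, this]
    · simp [hr]

theorem runs_findThreshold (hN : s.var 2 = N) (hM : N ≤ M) {ρ : Equiv.Perm (Fin N)}
    (hρ : ∀ p : Fin N, s.arr 5 p 0 0 = ρ p + 1) {best : Fin N} (hb : (ρ best : ℕ) = s.var 5) :
    Runs R M findThreshold s fun s' => s'.var 14 = s.arr 4 (s.var 5) best 0 := by
  refine (Runs.forLoop hN hM (fun i s' => (best : ℕ) < i →
    s'.var 14 = s.arr 4 (s.var 5) best 0) (by decide) rfl rfl
    (by simp) ?_).mono fun s' _ h => h best.2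
  intro i hi s₁ hx h₁ hI
  have e : s₁.arr 5 i 0 0 = ρ ⟨i, hi⟩ + 1 := (congrArg (fun f => f i 0 0) (h₁.arr 5 rfl)).trans
    (hρ ⟨i, hi⟩)
  refine Runs.ite (fun hc => Runs.assign ?_) (fun hc => Runs.skip ?_) <;>
    simp only [Test.holds, Expr.eval, cell, e, hx, h₁.var 5 rfl, ← hb] at hc
  · intro _
    have : (⟨i, hi⟩ : Fin N) = best := ρ.injective (Fin.ext (by omega))
    subst this
    simp [Expr.eval, cost, hx, h₁.var 5 rfl, h₁.arr 4 rfl]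
  · intro hlt
    rcases Nat.lt_succ_iff_lt_or_eq.1 hlt with hlt | rfl
    · simpa using hI hlt
    · simp at hc

theorem runs_penalize (hN : s.var 2 = N) (hM : N ≤ M) :
    Runs R M penalize s fun s' => ∀ r, ∀ p < N, s'.arr 4 r p 0 =
      if r = s.var 5 then (if s.arr 4 r p 0 ≤ s.var 14 then 0 else s.var 15)
      else s.arr 4 r p 0 := by
  refine (Runs.forLoop hN hM (fun i s' => ∀ r p, s'.arr 4 r p 0 =
    if r = s.var 5 ∧ p < i then (if s.arr 4 r p 0 ≤ s.var 14 then 0 else s.var 15)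
      else s.arr 4 r p 0)
    (by decide) rfl rfl (by simp) ?_).mono fun s' _ h r p hp => by simp [h r p, hp]
  intro i hi s₁ hx h₁ hI
  have ei : s₁.arr 4 (s.var 5) i 0 = s.arr 4 (s.var 5) i 0 := by simp [hI]
  have h5 := h₁.var 5 rfl
  refine Runs.ite (fun hc => Runs.store ?_) (fun hc => Runs.store ?_) <;>
    simp only [Test.holds, Expr.eval, cost, hx, h5, ei, h₁.var 14 rfl] at hc
  all_goals
    intro r p
    simp only [Expr.eval, Memory.setVar_arr, Memory.setArr_arr, hx, h5, hI r p, h₁.var 15 rfl]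
    by_cases hr : r = s.var 5
    · subst hr
      rcases lt_trichotomy p i with hp | rfl | hp
      · simp [hp, hp.ne, Nat.lt_succ_of_lt hp]
      · simp [hc]
      · have : ¬ p < i + 1 := by omega
        simp [hp.ne', hp.le, this]
    · simp [hr]

theorem runs_stages {B : ℕ} (hN : s.var 2 = N) (hB : N < B) (h15 : s.var 15 = (N + 1) * B)
    (h17 : s.var 17 = N + 1) (hc : ∀ r < N, ∀ p < N, s.arr 4 r p 0 = 0)
    (hM : N * ((N + 1) * (B + N) + 1) ≤ M) :
    Runs R M stages s fun s' => ∃ T, StageInv N B (weightIn R s) (fun r p => s'.arr 4 r p 0) N T := by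
  have hNM : N ≤ M := le_trans (Nat.le_mul_of_pos_right N (Nat.succ_pos _)) hM
  refine Runs.forLoop hN hNM (fun i s' => ∃ T, StageInv N B (weightIn R s)
    (fun r p => s'.arr 4 r p 0) i T) (by decide) rfl rfl ⟨fun _ => 0, StageInv.init hc⟩ ?_
  rintro q hq s₁ hx h₁ ⟨T, hI⟩
  have hw : weightIn R s₁ = weightIn R s := by
    funext q p
    simp only [weightIn, h₁.arr 3 rfl, h₁.arr 2 rfl]
  have e2 : s₁.var 2 = N := (h₁.var 2 rfl).trans hN
  have e17 : s₁.var 17 = N + 1 := (h₁.var 17 rfl).trans h17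
  have e15 : s₁.var 15 = (N + 1) * B := (h₁.var 15 rfl).trans h15
  refine Runs.seq (runs_countBetter e2 hNM) fun s₂ h₂ hc₂ => ?_
  rw [hw, hx, e17] at hc₂
  have f2 : s₂.var 2 = N := (h₂.var 2 rfl).trans e2
  -- At most `(N + 1) * B` from a penalty and `(N + 1) * N` from a count; this is the bound `C` of
  -- the auction.
  have hC : ∀ r < N, ∀ p < N, s₂.arr 4 r p 0 ≤ (N + 1) * (B + N) := by
    intro r hr p hp
    rw [hc₂ r p hp, mul_add]
    refine add_le_add (hI.cost_le hr hp) ?_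
    split_ifs
    · exact Nat.mul_le_mul_left _ (betterCount_le _ _ _ _)
    · exact Nat.zero_le _
  refine Runs.seq (runs_auction f2 hC hM) fun s₃ h₃ ⟨ρ, hown, hopt⟩ => ?_
  have g2 : s₃.var 2 = N := (h₃.var 2 rfl).trans f2
  have g5 : s₃.var 5 = q := (h₃.var 5 rfl).trans ((h₂.var 5 rfl).trans hx)
  have g4 : s₃.arr 4 = s₂.arr 4 := h₃.arr 4 rfl
  have hbest : (ρ (ρ.symm ⟨q, hq⟩) : ℕ) = q := by simp
  refine Runs.seq (runs_findThreshold g2 hNM hown (hbest.trans g5.symm)) fun s₄ h₄ h14 => ?_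
  have k2 : s₄.var 2 = N := (h₄.var 2 rfl).trans g2
  have k5 : s₄.var 5 = q := (h₄.var 5 rfl).trans g5
  have k4 : s₄.arr 4 = s₂.arr 4 := (h₄.arr 4 rfl).trans g4
  have k15 : s₄.var 15 = (N + 1) * B :=
    (h₄.var 15 rfl).trans ((h₃.var 15 rfl).trans ((h₂.var 15 rfl).trans e15))
  refine (runs_penalize k2 hNM).mono fun s₅ h₅ hc₅ => ⟨_, hI.step (c₁ := fun r p => s₂.arr 4 r p 0)
    hq hB (fun r hr p hp hrq => ?_) (fun p hp => ?_) hopt (fun r hr p hp hrq => ?_) hbest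
    (fun p hp => ?_)⟩
  · simp [hc₂ r p hp, hrq]
  · simp [hc₂ q p hp, hI.todo q le_rfl hq p hp]
  · simp [hc₅ r p hp, k5, hrq, k4]
  · simp only [Memory.setVar_arr, hc₅ q p hp, k5, if_true, k4, h14, k15, g5, g4]

theorem runs_computePenalty (hN : s.var 2 = N) (hM : N ≤ M) :
    Runs R M computePenalty s fun s' =>
      s'.var 17 = N + 1 ∧ s'.var 15 = (N + 1) * (N * N + 1) := by
  refine Runs.seq' (Runs.assign (Runs.seq' (Runs.assign ((Runs.forLoop (k := N)
    (by simpa using hN) hM (fun i s' => s'.var 15 = (N + 1) * (i * N + 1))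
    (by decide) rfl rfl ?_ ?_).mono ?_))))
  · simp [Expr.eval, hN]
  · intro i hi s₁ hx h₁ hI
    have e2 : s₁.var 2 = N := (h₁.var 2 rfl).trans (by simpa using hN)
    have e17 : s₁.var 17 = N + 1 := (h₁.var 17 rfl).trans (by simp [Expr.eval, hN])
    refine (Runs.forLoop e2 hM (fun j s' => s'.var 15 = (N + 1) * (i * N + j + 1))
      (by decide) rfl rfl (by simpa using hI) ?_).mono fun s₂ h₂ h => ?_
    · intro j hj s₂ hj' h₂ hI'
      refine Runs.assign ?_
      have f17 : s₂.var 17 = N + 1 := (h₂.var 17 rfl).trans e17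
      simp only [Memory.setVar_var, Expr.eval, hI', f17]
      norm_num
      ring
    · simp only [Memory.setVar_var, h]
      norm_num
      ring
  · intro s₁ h₁ h
    exact ⟨(h₁.var 17 rfl).trans (by simp [Expr.eval, hN]), h⟩

theorem runs_clearCosts (hN : s.var 2 = N) (hM : N ≤ M) :
    Runs R M clearCosts s fun s' => ∀ r < N, ∀ p < N, s'.arr 4 r p 0 = 0 := by
  refine Runs.forLoop hN hM (fun i s' => ∀ r < i, ∀ p < N, s'.arr 4 r p 0 = 0)
    (by decide) rfl rfl (by simp) ?_
  intro i hi s₁ hx h₁ hI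
  refine (Runs.forLoop ((h₁.var 2 rfl).trans hN) hM (fun j s' => (∀ p < j, s'.arr 4 i p 0 = 0) ∧
    ∀ r < i, ∀ p < N, s'.arr 4 r p 0 = 0) (by decide) rfl rfl (by simpa using hI) ?_).mono ?_
  · rintro j hj s₂ hj' h₂ ⟨hI1, hI2⟩
    have f6 : s₂.var 6 = i := (h₂.var 6 rfl).trans hx
    refine Runs.store ⟨fun p hp => ?_, fun r hr p hp => ?_⟩ <;>
      simp only [Expr.eval, Memory.setVar_arr, Memory.setArr_arr, hj', f6]
    · rcases Nat.lt_succ_iff_lt_or_eq.1 hp with hp | rfl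
      · simp [hI1 p hp]
      · simp
    · simp [hr.ne, hI2 r hr p hp]
  · rintro s₂ h₂ ⟨hI1, hI2⟩ r hr p hp
    rcases Nat.lt_succ_iff_lt_or_eq.1 hr with hr | rfl
    · exact hI2 r hr p hp
    · exact hI1 p hp

theorem runs_addRanks (hN : s.var 2 = N) (hM : N ≤ M) (hn : s.var 0 ≤ M) :
    Runs R M addRanks s fun s' => ∀ r < N, ∀ p < N, s'.arr 4 r p 0 = s.arr 4 r p 0 +
      s.var 17 * rankIn s r p := by
  refine (Runs.forLoop hN hM (fun i s' => ∀ r p, p < N → s'.arr 4 r p 0 = s.arr 4 r p 0 +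
    if r < i then s.var 17 * rankIn s r p else 0)
    (by decide) rfl rfl (by simp) ?_).mono fun s' _ h r hr p hp => by simp [h r p hp, hr]
  intro i hi s₁ hx h₁ hI
  refine (Runs.forLoop ((h₁.var 2 rfl).trans hN) hM (fun j s' => ∀ r p,
    s'.arr 4 r p 0 = s₁.arr 4 r p 0 + if r = i ∧ p < j then s.var 17 * rankIn s r p else 0)
    (by decide) rfl rfl (by simp) ?_).mono fun s₂ h₂ hI₂ r p hp => ?_
  · intro j hj s₂ hj' h₂ hI₂
    refine (runs_countCost (P := fun t => 1 ≤ s.arr 0 (s.arr 2 j 0 0) t (s.arr 3 i 0 0) ∧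
      ¬ 1 ≤ s.arr 0 (s.arr 2 j 0 0) (s.arr 3 i 0 0) t)
      (by decide) (by decide) (by decide) (by decide)
      ((h₂.var 0 rfl).trans (h₁.var 0 rfl)) hn ?_).mono ?_
    · intro l hl s₃ hl' h₃
      simp only [Test.holds, Expr.eval, cell, hl', h₃.arr 3 rfl, h₃.arr 2 rfl, h₃.arr 0 rfl,
        h₂.arr 3 rfl, h₂.arr 2 rfl, h₂.arr 0 rfl, h₁.arr 3 rfl, h₁.arr 2 rfl, h₁.arr 0 rfl,
        h₃.var 7 rfl, h₃.var 6 rfl, h₂.var 6 rfl, hj', hx]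
    · intro s₃ h₃ hc r p
      simp only [Memory.setVar_arr, hc r p, hI₂ r p, h₂.var 6 rfl, hx, hj', h₂.var 17 rfl,
        h₁.var 17 rfl]
      by_cases hr : r = i
      · subst hr
        rcases lt_trichotomy p j with hp | rfl | hp
        · simp [hp, hp.ne, Nat.lt_succ_of_lt hp]
        · simp [rankIn]
        · have : ¬ p < j + 1 := by omega
          simp [hp.ne', hp.le, this]
      · simp [hr]
  · simp only [Memory.setVar_arr, hI₂ r p, hI r p hp, hp, and_true]
    rcases lt_trichotomy r i with hr | rfl | hr
    · simp [hr, hr.ne, Nat.lt_succ_of_lt hr]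
    · simp
    · have : ¬ r < i + 1 := by omega
      simp [hr.ne', hr.le, this]

theorem runs_solve (hN : s.var 2 = N) (hn : s.var 0 ≤ N)
    (hM : N * ((N + 1) * (N * N + 1 + N) + 1) ≤ M) :
    Runs R M solve s fun s' => ∃ ρ : Equiv.Perm (Fin N),
      (∀ p : Fin N, s'.arr 5 p 0 0 = ρ p + 1) ∧
      (∀ (ν : Equiv.Perm (Fin N)) (q : Fin N),
        (∀ r < q, weightIn R s r (ν r) = weightIn R s r (ρ.symm r)) →
          weightIn R s q (ν q) ≤ weightIn R s q (ρ.symm q)) ∧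
      ∀ ν : Equiv.Perm (Fin N),
        (∀ q : Fin N, weightIn R s q (ν q) = weightIn R s q (ρ.symm q)) →
          ∑ p, rankIn s (ρ p) p ≤ ∑ p, rankIn s (ν.symm p) p := by
  have hNM : N ≤ M := le_trans (Nat.le_mul_of_pos_right N (Nat.succ_pos _)) hM
  refine Runs.seq (runs_computePenalty hN hNM) fun s₁ h₁ ⟨h17, h15⟩ => ?_
  have e2 : s₁.var 2 = N := (h₁.var 2 rfl).trans hN
  refine Runs.seq (runs_clearCosts e2 hNM) fun s₂ h₂ hc => ?_
  have f2 : s₂.var 2 = N := (h₂.var 2 rfl).trans e2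
  have f17 : s₂.var 17 = N + 1 := (h₂.var 17 rfl).trans h17
  refine Runs.seq (runs_stages f2 (by nlinarith) ((h₂.var 15 rfl).trans h15) f17 hc hM)
    fun s₃ h₃ ⟨T, hI⟩ => ?_
  have g2 : s₃.var 2 = N := (h₃.var 2 rfl).trans f2
  have g0 : s₃.var 0 = s.var 0 := (h₃.var 0 rfl).trans ((h₂.var 0 rfl).trans (h₁.var 0 rfl))
  have hw : weightIn R s₂ = weightIn R s := by
    funext q p
    simp only [weightIn, h₁.arr 3 rfl, h₁.arr 2 rfl, h₂.arr 3 rfl, h₂.arr 2 rfl]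
  have hr : rankIn s₃ = rankIn s := by
    funext q p
    simp only [rankIn, g0, h₁.arr 3 rfl, h₁.arr 2 rfl, h₂.arr 3 rfl, h₂.arr 2 rfl,
      h₃.arr 3 rfl, h₃.arr 2 rfl, h₁.arr 0 rfl, h₂.arr 0 rfl, h₃.arr 0 rfl]
  have hle : ∀ q p, rankIn s q p ≤ N := fun q p => (countBelow_le _ _).trans hn
  rw [hw] at hI
  refine Runs.seq (runs_addRanks g2 hNM (g0.le.trans (hn.trans hNM))) fun s₄ h₄ hc₄ => ?_
  rw [hr, (h₃.var 17 rfl).trans f17] at hc₄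
  have k2 : s₄.var 2 = N := (h₄.var 2 rfl).trans g2
  refine (runs_auction k2 (C := (N + 1) * (N * N + 1 + N)) (fun r hr p hp => ?_) hM).mono ?_
  · rw [hc₄ r hr p hp, mul_add]
    exact add_le_add (hI.cost_le hr hp) (Nat.mul_le_mul_left _ (hle _ _))
  · rintro s₅ h₅ ⟨ρ, hown, hopt⟩
    refine ⟨ρ, hown, hI.final (c₁ := fun r p => s₄.arr 4 r p 0) (fun σ => ?_) hc₄ hopt⟩
    -- `N` ranks (minus one) of at most `N` each stay below the penalty `B = N * N + 1`.
    refine Nat.lt_succ_of_le ((Finset.sum_le_card_nsmul _ _ N fun p _ => hle _ _).trans ?_)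
    simp

end Prog

/-! ### From memory contents to instances -/

theorem countBelow_eq_card {n : ℕ} {P : ℕ → Prop} {Q : Fin n → Prop} [DecidablePred Q]
    (h : ∀ i : Fin n, P i ↔ Q i) : countBelow n P = (Finset.univ.filter Q).card := by
  classical
  rw [countBelow]
  symm
  refine Finset.card_bij (fun i _ => (i : ℕ)) (fun i hi => ?_) (fun i _ j _ => Fin.ext)
    fun i hi => ?_
  · rw [Finset.mem_filter] at hi ⊢
    exact ⟨Finset.mem_range.2 i.2, (h i).2 hi.2⟩
  · rw [Finset.mem_filter, Finset.mem_range] at hi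
    exact ⟨⟨i, hi.1⟩, Finset.mem_filter.2 ⟨Finset.mem_univ _, (h ⟨i, hi.1⟩).1 hi.2⟩, rfl⟩

namespace Instance

theorem table_apply {n m : ℕ} (I : Instance n (Fin m)) (i : Fin n) (p : Fin m) :
    I.table i p = I.value i p := by
  simp [table]

/-- The index `m`, just outside the table, represents every dummy and also provides the constant 0
for sign tests. -/
theorem table_of_le {n m : ℕ} (I : Instance n (Fin m)) (i : ℕ) {p : ℕ} (hp : m ≤ p) :
    I.table i p = 0 := by
  simp [table, not_lt.2 hp]

theorem one_le_input_arr {n m : ℕ} (I : Instance n (Fin m)) (p : Fin m) (i j : Fin n) :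
    1 ≤ I.input.arr 0 p i j ↔ I.pref p i j := by
  simp only [input]
  split_ifs with h
  · exact ⟨fun _ => h.2.2.2.2, fun _ => le_rfl⟩
  · exact ⟨fun h' => by omega, fun h' => absurd ⟨rfl, p.2, i.2, j.2, h'⟩ h⟩

theorem input_arr_of_le {n m : ℕ} (I : Instance n (Fin m)) {p : ℕ} (hp : m ≤ p) (i j : ℕ) :
    I.input.arr 0 p i j = 0 := by
  simp only [input]
  rw [if_neg]
  rintro ⟨-, hp', -⟩
  omega

/-- One matching serves as both the lexicographic maximum and the rank minimizer. `ρ` sends columns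
to rows, so the matching from positions to players is its inverse. -/
theorem RoundRobinOutput.of_perm {n : ℕ} {P : Type*} [NeZero n] [Fintype P] (I : Instance n P)
    (order : Equiv.Perm (Fin n)) {N : ℕ} (E : Fin N ≃ P) (ρ : Equiv.Perm (Fin N))
    {w : ℕ → ℕ → ℝ} {g : ℕ → ℕ → ℕ} (hw : ∀ q p : Fin N, w q p = I.value (Instance.turn order q) (E p))
    (hg : ∀ q p : Fin N, I.rank (E p) (Instance.turn order q) = 1 + g q p)
    (hlex : ∀ (ν : Equiv.Perm (Fin N)) (q : Fin N),
      (∀ r < q, w r (ν r) = w r (ρ.symm r)) → w q (ν q) ≤ w q (ρ.symm q))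
    (hmin : ∀ ν : Equiv.Perm (Fin N), (∀ q : Fin N, w q (ν q) = w q (ρ.symm q)) →
      ∑ p, g (ρ p) p ≤ ∑ p, g (ν.symm p) p) :
    I.RoundRobinOutput order fun x => turn order (ρ (E.symm x)) := by
  obtain rfl : N = Fintype.card P := by simpa using Fintype.card_congr E
  have hW : ∀ (ν : Fin (Fintype.card P) ≃ P) (q : Fin (Fintype.card P)),
      I.weight order q (ν q) = w q ((ν.trans E.symm : Equiv.Perm _) q) := fun ν q => by
    simp [hw, weight]
  have hR : ∀ ν : Fin (Fintype.card P) ≃ P, I.rankSum order ν =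
      ∑ p : Fin (Fintype.card P), (1 + g ((ν.trans E.symm : Equiv.Perm _).symm p) p) := by
    intro ν
    rw [rankSum, ← E.sum_comp]
    exact Finset.sum_congr rfl fun p _ => by simp [← hg]
  have hρ : (ρ.symm.trans E).trans E.symm = ρ.symm := by ext; simp
  refine ⟨ρ.symm.trans E, ρ.symm.trans E, fun ν q hq => ?_, fun _ => rfl, fun ν hν => ?_,
    fun x => by simp⟩
  · rw [hW, hW, hρ]
    exact hlex _ q fun r hr => by
      have := hq r hr
      rwa [hW, hW, hρ] at this
  · rw [hR, hR, hρ, Finset.sum_add_distrib, Finset.sum_add_distrib]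
    refine Nat.add_le_add_left (hmin _ fun q => ?_) _
    have := hν q
    rwa [hW, hW, hρ] at this

end Instance

namespace Prog

variable {n m M : ℕ} {s : Memory}

theorem runs_collect {I : Instance n (Fin m)} {S : Finset (Fin m)} {b : Test}
    (hb : ∀ (s' : Memory) (p : Fin m), s'.var 16 ≤ 1 →
      (s'.var 16 = 1 ↔ ∃ i, 0 ≤ I.value i p) → (b.holds I.table s' ↔ p ∈ S))
    (hn : s.var 0 = n) (hm : s.var 1 = m) (hnM : n ≤ M) (hmM : m ≤ M) :
    Runs I.table M (collect b) s fun s' => s'.var 3 = S.card ∧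
      ∃ e : Fin S.card ≃ {p // p ∈ S}, ∀ k : Fin S.card, s'.arr 2 k 0 0 = (e k).1 := by
  refine Runs.seq' (Runs.assign ((Runs.forLoop (k := m) (by simpa using hm) hmM (fun i s' =>
    s'.var 3 = (S.filter fun p : Fin m => (p : ℕ) < i).card ∧
    (∀ k < s'.var 3, ∃ p ∈ S, (p : ℕ) < i ∧ s'.arr 2 k 0 0 = p) ∧
    ∀ k < s'.var 3, ∀ k' < s'.var 3, s'.arr 2 k 0 0 = s'.arr 2 k' 0 0 → k = k')
    (by decide) rfl rfl (by simp [Expr.eval]) ?_).mono ?_))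
  · rintro i hi s₁ hx h₁ ⟨hI1, hI2, hI3⟩
    have e0 : s₁.var 0 = n := (h₁.var 0 rfl).trans (by simpa using hn)
    have e1 : s₁.var 1 = m := (h₁.var 1 rfl).trans (by simpa using hm)
    refine Runs.seq' (Runs.assign (Runs.seq (Runs.forLoop (k := n) (by simpa using e0) hnM
      (fun j s' => s'.var 16 ≤ 1 ∧
        (s'.var 16 = 1 ↔ ∃ t : Fin n, (t : ℕ) < j ∧ 0 ≤ I.value t ⟨i, hi⟩))
      (by decide) rfl rfl (by simp [Expr.eval]) ?_) fun s₂ h₂ ⟨hf1, hf2⟩ => ?_))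
    · rintro j hj s₂ hj' h₂ ⟨hf1, hf2⟩
      have f1 : s₂.var 1 = m := (h₂.var 1 rfl).trans (by simpa using e1)
      have f7 : s₂.var 7 = i := (h₂.var 7 rfl).trans (by simpa using hx)
      -- The table entry `(0, m)` is 0, so the test is a sign test for player `i`.
      refine Runs.ite (fun hc => Runs.assign ?_) (fun hc => Runs.skip ?_) <;>
        simp only [Test.holds, Expr.eval, hj', f1, f7, I.table_of_le 0 le_rfl,
          I.table_apply ⟨j, hj⟩ ⟨i, hi⟩] at hc
      · have : ∃ t : Fin n, (t : ℕ) ≤ j ∧ 0 ≤ I.value t ⟨i, hi⟩ :=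
          ⟨⟨j, hj⟩, le_rfl, hc⟩
        simp [Expr.eval, this]
      · simp only [Memory.setVar_var, Nat.reduceEqDiff, if_false, hf2]
        refine ⟨hf1, ⟨fun ⟨t, ht, h⟩ => ⟨t, by omega, h⟩, fun ⟨t, ht, h⟩ => ⟨t, ?_, h⟩⟩⟩
        rcases Nat.lt_succ_iff_lt_or_eq.1 ht with ht | ht
        · exact ht
        · obtain rfl : t = ⟨j, hj⟩ := Fin.ext ht
          exact absurd h hc
    · have f3 : s₂.var 3 = s₁.var 3 := (h₂.var 3 rfl).trans (by simp)
      have f7 : s₂.var 7 = i := (h₂.var 7 rfl).trans (by simpa using hx)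
      have fa : s₂.arr 2 = s₁.arr 2 := h₂.arr 2 rfl
      have hb' := hb s₂ ⟨i, hi⟩ hf1 (hf2.trans
        ⟨fun ⟨t, _, h⟩ => ⟨t, h⟩, fun ⟨t, h⟩ => ⟨t, t.2, h⟩⟩)
      rw [← f3, ← fa] at hI2 hI3
      rw [← f3] at hI1
      refine Runs.ite (fun hc => Runs.seq' (Runs.store (Runs.assign ?_)))
        (fun hc => Runs.skip ?_) <;> rw [hb'] at hc
      · have hcard : (S.filter fun p : Fin m => (p : ℕ) < i + 1).card =
            (S.filter fun p : Fin m => (p : ℕ) < i).card + 1 := by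
          have : (S.filter fun p : Fin m => (p : ℕ) < i + 1) =
              insert ⟨i, hi⟩ (S.filter fun p : Fin m => (p : ℕ) < i) := by
            ext p
            simp only [Finset.mem_filter, Finset.mem_insert, Nat.lt_succ_iff_lt_or_eq]
            constructor
            · rintro ⟨hp, hlt | he⟩
              · exact Or.inr ⟨hp, hlt⟩
              · exact Or.inl (Fin.ext he)
            · rintro (rfl | ⟨hp, hlt⟩)
              · exact ⟨hc, Or.inr rfl⟩
              · exact ⟨hp, Or.inl hlt⟩
          rw [this, Finset.card_insert_of_notMem (by simp)]
        simp only [Memory.setVar_var, Memory.setArr_var, Memory.setVar_arr, Memory.setArr_arr,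
          Expr.eval, f7, Nat.reduceEqDiff, if_false, if_true, hcard, hI1, true_and, and_true]
        rw [hI1] at hI2 hI3
        refine ⟨fun k hk => ?_, fun k hk k' hk' he => ?_⟩
        · split_ifs with hk'
          · exact ⟨⟨i, hi⟩, hc, Nat.lt_succ_self i, rfl⟩
          · obtain ⟨p, hp, hlt, h⟩ := hI2 k (by omega)
            exact ⟨p, hp, by omega, h⟩
        · split_ifs at he with h1 h2 h2
          · rw [h1, h2]
          · obtain ⟨p, -, hlt, h⟩ := hI2 k' (by omega)
            omega
          · obtain ⟨p, -, hlt, h⟩ := hI2 k (by omega)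
            omega
          · exact hI3 k (by omega) k' (by omega) he
      · have hcard : (S.filter fun p : Fin m => (p : ℕ) < i + 1) = S.filter fun p : Fin m => (p : ℕ) < i := by
          refine Finset.filter_congr fun p hp => ?_
          have : (p : ℕ) ≠ i := fun he => hc (by rwa [← (Fin.ext he : p = ⟨i, hi⟩)])
          omega
        simp only [Memory.setVar_var, Memory.setVar_arr, Nat.reduceEqDiff, if_false, hcard]
        refine ⟨hI1, fun k hk => ?_, hI3⟩
        obtain ⟨p, hp, hlt, h⟩ := hI2 k hk
        exact ⟨p, hp, by omega, h⟩
  · rintro s₁ - ⟨hI1, hI2, hI3⟩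
    have hcard : (S.filter fun p : Fin m => (p : ℕ) < m) = S :=
      Finset.filter_true_of_mem fun p _ => p.2
    rw [hcard] at hI1
    refine ⟨hI1, ?_⟩
    rw [hI1] at hI2 hI3
    choose f hf1 hf2 hf3 using hI2
    let e : Fin S.card → {p // p ∈ S} := fun k => ⟨f k k.2, hf1 k k.2⟩
    have he : Function.Bijective e := by
      rw [Fintype.bijective_iff_injective_and_card]
      refine ⟨fun k k' hkk => Fin.ext (hI3 k k.2 k' k'.2 ?_), by simp⟩
      have hf : f k k.2 = f k' k'.2 := Subtype.ext_iff.1 hkk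
      rw [hf3 k k.2, hf3 k' k'.2, hf]
    exact ⟨Equiv.ofBijective e he, fun k => hf3 k k.2⟩

theorem runs_computeTurns [NeZero n] {R : ℕ → ℕ → ℝ} {order : Equiv.Perm (Fin n)} {e : Expr}
    (he : ∀ (s' : Memory) (t : Fin n), s'.var 0 = n → s'.var 9 = t → e.eval s' = order t)
    {K : ℕ} (hn : s.var 0 = n) (hK : s.var 3 = K) (hnM : n ≤ M) (hKM : K + 1 ≤ M) :
    Runs R M (computeTurns e) s fun s' => s'.var 2 = (K + 1) * n ∧
      ∀ q < (K + 1) * n, s'.arr 3 q 0 0 = Instance.turn order q := by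
  have hturn : ∀ (i : ℕ) (t : Fin n), Instance.turn order (i * n + t) = order t := fun i t => by
    unfold Instance.turn
    congr 1
    ext
    simp [Fin.ofNat, Nat.mod_eq_of_lt t.2]
  refine Runs.seq' (Runs.assign (Runs.seq' (Runs.assign (Runs.forLoop (k := K + 1)
    (by simp [Expr.eval, hK]) hKM (fun i s' => s'.var 2 = i * n ∧
      ∀ q < i * n, s'.arr 3 q 0 0 = Instance.turn order q) (by decide) rfl rfl (by simp [Expr.eval]) ?_))))
  rintro i hi s₁ hx h₁ ⟨hI1, hI2⟩
  have e0 : s₁.var 0 = n := (h₁.var 0 rfl).trans (by simpa using hn)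
  refine (Runs.forLoop e0 hnM (fun j s' => s'.var 2 = i * n + j ∧
      ∀ q < i * n + j, s'.arr 3 q 0 0 = Instance.turn order q) (by decide) rfl rfl
      (by simpa using ⟨hI1, hI2⟩) ?_).mono fun s₂ _ h => by simpa [add_mul] using h
  rintro j hj s₂ hj' h₂ ⟨hJ1, hJ2⟩
  have f0 : s₂.var 0 = n := (h₂.var 0 rfl).trans e0
  refine Runs.seq' (Runs.store (Runs.assign ?_))
  simp only [Memory.setVar_var, Memory.setArr_var, Memory.setVar_arr, Memory.setArr_arr,
    Expr.eval, Nat.reduceEqDiff, if_false, if_true, hJ1, he s₂ ⟨j, hj⟩ f0 hj', true_and, and_true]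
  refine ⟨by omega, fun q hq => ?_⟩
  split_ifs with hq'
  · rw [hq', ← hturn i ⟨j, hj⟩]
  · exact hJ2 q (by omega)

theorem runs_addDummies {R : ℕ → ℕ → ℝ} {N K : ℕ} (hN : s.var 2 = N) (hM : N ≤ M)
    (hK : s.var 3 = K) (hm : s.var 1 = m) :
    Runs R M addDummies s fun s' => ∀ k < N, s'.arr 2 k 0 0 =
      if K ≤ k then m else s.arr 2 k 0 0 := by
  refine (Runs.forLoop hN hM (fun i s' => ∀ k, s'.arr 2 k 0 0 =
    if K ≤ k ∧ k < i then m else s.arr 2 k 0 0) (by decide) rfl rfl (by simp) ?_).mono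
    fun s' _ h k hk => by simp [h k, hk]
  intro i hi s₁ hx h₁ hI
  have e1 := (h₁.var 1 rfl).trans hm
  have e3 := (h₁.var 3 rfl).trans hK
  refine Runs.ite (fun hc => Runs.store ?_) (fun hc => Runs.skip ?_) <;>
    simp only [Test.holds, Expr.eval, e3, hx] at hc
  · intro k
    simp only [Expr.eval, Memory.setVar_arr, Memory.setArr_arr, hx, e1, hI k]
    rcases lt_trichotomy k i with hk | rfl | hk
    · simp [hk, hk.ne, Nat.lt_succ_of_lt hk]
    · simp [hc]
    · have : ¬ k < i + 1 := by omega
      simp [hk.ne', hk.le, this]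
  · intro k
    simp only [Memory.setVar_arr, hI k]
    rcases lt_trichotomy k i with hk | rfl | hk
    · simp [hk, Nat.lt_succ_of_lt hk]
    · simp [hc]
    · have : ¬ k < i + 1 := by omega
      simp [hk.le, this]

/-- The second clause ensures that the run on one part keeps the output written for the other. -/
theorem runs_writeTeams {R : ℕ → ℕ → ℝ} {K : ℕ} (hK : s.var 3 = K) (hM : K ≤ M)
    (hinj : ∀ k < K, ∀ k' < K, s.arr 2 k 0 0 = s.arr 2 k' 0 0 → k = k') :
    Runs R M writeTeams s fun s' =>
      (∀ k < K, s'.arr 1 (s.arr 2 k 0 0) 0 0 = s.arr 3 (s.arr 5 k 0 0 - 1) 0 0) ∧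
      ∀ x, (∀ k < K, x ≠ s.arr 2 k 0 0) → s'.arr 1 x 0 0 = s.arr 1 x 0 0 := by
  refine Runs.forLoop hK hM (fun i s' =>
    (∀ k < i, s'.arr 1 (s.arr 2 k 0 0) 0 0 = s.arr 3 (s.arr 5 k 0 0 - 1) 0 0) ∧
      ∀ x, (∀ k < i, x ≠ s.arr 2 k 0 0) → s'.arr 1 x 0 0 = s.arr 1 x 0 0)
    (by decide) rfl rfl (by simp) ?_
  rintro i hi s₁ hx h₁ ⟨hI1, hI2⟩
  refine Runs.store ?_
  simp only [Expr.eval, cell, Memory.setVar_arr, Memory.setArr_arr, hx, h₁.arr 2 rfl,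
    h₁.arr 3 rfl, h₁.arr 5 rfl, true_and, and_true]
  refine ⟨fun k hk => ?_, fun x hx' => ?_⟩
  · split_ifs with he
    · rw [hinj k (by omega) i hi he]
    · refine hI1 k ?_
      rcases Nat.lt_succ_iff_lt_or_eq.1 hk with hk | rfl
      · exact hk
      · exact absurd rfl he
  · rw [if_neg (hx' i (Nat.lt_succ_self i))]
    exact hI2 x fun k hk => hx' k (by omega)

/-- Nothing is assumed about the work arrays, so this also covers the second run, which starts in
the memory left by the first. `X` bounds the number of positions whatever the size of `S`. -/
theorem runs_roundRobin [NeZero n] {I : Instance n (Fin m)} {S : Finset (Fin m)} {b : Test}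
    {e : Expr} {order : Equiv.Perm (Fin n)}
    (hb : ∀ (s' : Memory) (p : Fin m), s'.var 16 ≤ 1 →
      (s'.var 16 = 1 ↔ ∃ i, 0 ≤ I.value i p) → (b.holds I.table s' ↔ p ∈ S))
    (he : ∀ (s' : Memory) (t : Fin n), s'.var 0 = n → s'.var 9 = t → e.eval s' = order t)
    (hn : s.var 0 = n) (hm : s.var 1 = m) (hpref : s.arr 0 = I.input.arr 0) {X : ℕ}
    (hX : (m + 1) * n ≤ X) (hM : X * ((X + 1) * (X * X + 1 + X) + 1) ≤ M) :
    Runs I.table M (roundRobin b e) s fun s' =>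
      ∃ D : Allocation n ({p // p ∈ S} ⊕ Fin ((n - 1) * S.card + n)),
        (I.withDummies S).RoundRobinOutput order D ∧
        (∀ p (hp : p ∈ S), s'.arr 1 p 0 0 = D (Sum.inl ⟨p, hp⟩)) ∧
        ∀ p : Fin m, p ∉ S → s'.arr 1 p 0 0 = s.arr 1 p 0 0 := by
  have hn0 : 0 < n := Nat.pos_of_ne_zero (NeZero.ne n)
  have hXM : X ≤ M := le_trans (Nat.le_mul_of_pos_right X (Nat.succ_pos _)) hM
  have hmX : m + 1 ≤ X := (Nat.le_mul_of_pos_right _ hn0).trans hX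
  have hSm : S.card ≤ m := by simpa using S.card_le_univ
  set N := (S.card + 1) * n with hNdef
  have hNX : N ≤ X := (Nat.mul_le_mul_right n (by omega)).trans hX
  have hnN : n ≤ N := Nat.le_mul_of_pos_left n (Nat.succ_pos _)
  have hKN : S.card + 1 ≤ N := Nat.le_mul_of_pos_right _ hn0
  refine Runs.seq (runs_collect hb hn hm (by omega) (by omega)) fun s₁ h₁ ⟨hK, ε, hε⟩ => ?_
  have e0 : s₁.var 0 = n := (h₁.var 0 rfl).trans hn
  refine Runs.seq (runs_computeTurns he e0 hK (by omega) (by omega))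
    fun s₂ h₂ ⟨hN, hturn⟩ => ?_
  have f1 : s₂.var 1 = m := (h₂.var 1 rfl).trans ((h₁.var 1 rfl).trans hm)
  have f3 : s₂.var 3 = S.card := (h₂.var 3 rfl).trans hK
  refine Runs.seq (runs_addDummies hN (by omega) f3 f1) fun s₃ h₃ hcol => ?_
  have g0 : s₃.var 0 = n := (h₃.var 0 rfl).trans ((h₂.var 0 rfl).trans e0)
  have g2 : s₃.var 2 = N := (h₃.var 2 rfl).trans hN
  have gt : ∀ q : Fin N, s₃.arr 3 q 0 0 = Instance.turn order q := fun q => by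
    rw [h₃.arr 3 rfl]; exact hturn q q.2
  have gp : s₃.arr 0 = I.input.arr 0 := by
    rw [h₃.arr 0 rfl, h₂.arr 0 rfl, h₁.arr 0 rfl, hpref]
  have greal : ∀ k : Fin S.card, s₃.arr 2 k 0 0 = (ε k).1 := fun k => by
    rw [hcol k (by omega), if_neg (by omega), h₂.arr 2 rfl, hε]
  have gdummy : ∀ k, S.card ≤ k → k < N → s₃.arr 2 k 0 0 = m := fun k hk hkN => by
    rw [hcol k hkN, if_pos hk]
  have hcard : N = S.card + ((n - 1) * S.card + n) := by
    have := Instance.card_withDummies n S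
    simp only [Fintype.card_sum, Fintype.card_coe, Fintype.card_fin] at this
    omega
  -- The first `|S|` columns are the collected players, the others the dummies.
  let E : Fin N ≃ {p // p ∈ S} ⊕ Fin ((n - 1) * S.card + n) :=
    (finCongr hcard).trans (finSumFinEquiv.symm.trans (Equiv.sumCongr ε (Equiv.refl _)))
  have hE : ∀ k : Fin S.card, E.symm (Sum.inl (ε k)) = ⟨k, by omega⟩ := fun k => by
    ext
    simp [E]
  have hEcase : ∀ p : Fin N, (∃ k, E p = Sum.inl (ε k) ∧ s₃.arr 2 p 0 0 = (ε k).1) ∨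
      ∃ d, E p = Sum.inr d ∧ s₃.arr 2 p 0 0 = m := by
    intro p
    rcases hp : E p with x | d
    · left
      obtain ⟨k, rfl⟩ := ε.surjective x
      refine ⟨k, rfl, ?_⟩
      rw [← E.symm_apply_eq.2 hp.symm, hE, ← greal]
    · right
      refine ⟨d, rfl, gdummy p ?_ p.2⟩
      rw [← E.symm_apply_eq.2 hp.symm]
      simp [E]
  refine Runs.seq (runs_solve g2 (by omega) (le_trans ?_ hM)) fun s₄ h₄ ⟨ρ, hown, hlex, hmin⟩ => ?_
  · gcongr
  have hRR := Instance.RoundRobinOutput.of_perm (I.withDummies S) order E ρ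
    (w := weightIn I.table s₃) (g := rankIn s₃) (fun q p => ?_) (fun q p => ?_) hlex hmin
  · have k2 : ∀ k : Fin S.card, s₄.arr 2 k 0 0 = (ε k).1 := fun k => by
      rw [h₄.arr 2 rfl, greal]
    refine (runs_writeTeams ((h₄.var 3 rfl).trans ((h₃.var 3 rfl).trans f3)) (by omega)
      fun k hk k' hk' hkk => ?_).mono fun s₅ h₅ ⟨hw1, hw2⟩ => ⟨_, hRR, fun p hp => ?_,
        fun p hp => ?_⟩
    · rw [k2 ⟨k, hk⟩, k2 ⟨k', hk'⟩] at hkk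
      simpa using ε.injective (Subtype.ext (Fin.ext hkk))
    · obtain ⟨k, hk⟩ := ε.surjective ⟨p, hp⟩
      have h1 := hw1 k k.2
      rw [k2, hk, h₄.arr 3 rfl] at h1
      have h2 := hown ⟨k, by omega⟩
      simp only at h2
      rw [h2, Nat.add_sub_cancel, gt] at h1
      rw [h1, ← hk, hE]
    · rw [hw2 p fun k hk he => hp ?_, h₄.arr 1 rfl, h₃.arr 1 rfl, h₂.arr 1 rfl, h₁.arr 1 rfl]
      rw [k2 ⟨k, hk⟩] at he
      rw [Fin.ext he]
      exact (ε ⟨k, hk⟩).2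
  · rw [weightIn, gt]
    rcases hEcase p with ⟨k, hp, hc⟩ | ⟨d, hp, hc⟩
    · rw [hp, hc, I.table_apply]
      rfl
    · rw [hp, hc, I.table_of_le _ le_rfl]
      rfl
  · rw [Instance.rank, rankIn, gt, gp, g0]
    congr 1
    symm
    classical
    refine countBelow_eq_card fun i => ?_
    rcases hEcase p with ⟨k, hp, hc⟩ | ⟨d, hp, hc⟩
    · rw [hp, hc, I.one_le_input_arr, I.one_le_input_arr]
      rfl
    · rw [hp, hc, I.input_arr_of_le le_rfl, I.input_arr_of_le le_rfl]
      -- The memory records no preference for a dummy, the instance records all of them; strict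
      -- preference is empty either way.
      simp [Instance.strictPref, Instance.withDummies]

end Prog

/-! ### The two runs combined -/

theorem doubleRoundRobinPolyTime : DoubleRoundRobinPolyTime := by
  -- At `n + m` this bounds the `(|S| + 1) * n` positions of either part; the program's time is
  -- evaluated at the resulting bound for all loop lengths.
  let Y : Polynomial ℕ := (Polynomial.X + 1) * Polynomial.X
  refine ⟨Prog.doubleRoundRobin, Prog.doubleRoundRobin.time.comp
    (Y * ((Y + 1) * (Y * Y + 1 + Y) + 1)), fun n m _ I => ?_⟩
  set x := (n + m + 1) * (n + m) with hx
  have hxle : (m + 1) * n ≤ x := Nat.mul_le_mul (by omega) (by omega)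
  have hrun : Runs I.table (x * ((x + 1) * (x * x + 1 + x) + 1)) Prog.doubleRoundRobin I.input
      fun s => ∃ A : Allocation n (Fin m), s.Encodes A ∧ I.DoubleRoundRobinOutput A := by
    refine Runs.seq (Prog.runs_roundRobin (I := I) (S := I.posPlayers)
      (order := Equiv.refl (Fin n)) (fun s' p h1 h2 => ?_) (fun s' t _ h => ?_) rfl rfl rfl
      hxle le_rfl) fun s₁ h₁ ⟨B, hB, hB1, _⟩ => ?_
    · rw [Instance.mem_posPlayers, ← h2]
      simp only [Test.holds, Expr.eval]
      omega
    · simp [Expr.eval, h]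
    refine (Prog.runs_roundRobin (I := I) (S := I.negPlayers)
      (order := Fin.revPerm) (fun s' p h1 h2 => ?_) (fun s' t h0 h => ?_) (h₁.var 0 rfl)
      (h₁.var 1 rfl) (h₁.arr 0 rfl) hxle le_rfl).mono fun s₂ h₂ ⟨C, hC, hC1, hC2⟩ => ?_
    · rw [← not_iff_not, Instance.notMem_negPlayers, Instance.mem_posPlayers, ← h2]
      simp only [Test.holds, Expr.eval]
      omega
    · simp only [Expr.eval, h0, h, Fin.revPerm_apply, Fin.val_rev]
      omega
    · classical
      have hneg : ∀ p, p ∉ I.posPlayers → p ∈ I.negPlayers := fun p hp => by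
        by_contra h
        exact hp (Instance.notMem_negPlayers.1 h)
      let A : Allocation n (Fin m) := fun p =>
        if h : p ∈ I.posPlayers then B (Sum.inl ⟨p, h⟩) else C (Sum.inl ⟨p, hneg p h⟩)
      refine ⟨A, fun p => ?_, B, C, hB, hC, fun p hp => dif_pos hp, fun p hp => dif_neg fun h => ?_⟩
      -- The second run leaves the entries of the nonnegative part untouched.
      · by_cases hp : p ∈ I.posPlayers
        · rw [hC2 p (Instance.notMem_negPlayers.2 hp), hB1 p hp]
          simp [A, hp]
        · rw [hC1 p (hneg p hp)]
          simp [A, hp]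
      · exact absurd hp (Instance.notMem_negPlayers.2 h)
  obtain ⟨t, s, hexec, ht, A, hA, hout⟩ := hrun
  refine ⟨t, s, A, hexec, ?_, hA, hout⟩
  simpa [Y, Polynomial.eval_comp, hx] using ht

end TeamAlloc

theorem theorem2 :
    (∀ (n m : ℕ) [NeZero n] (I : TeamAlloc.Instance n (Fin m))
        (A : TeamAlloc.Allocation n (Fin m)), I.DoubleRoundRobinOutput A →
          I.EF1 A ∧ I.SwapStable A ∧ I.IndividuallyStable A) ∧
    TeamAlloc.DoubleRoundRobinPolyTime :=
  ⟨fun _ _ _ _ _ h => ⟨h.ef1, h.swapStable, h.individuallyStable⟩,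
    TeamAlloc.doubleRoundRobinPolyTime⟩
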